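/- All vector spaces are over $\mathbb C$, and Sweedler notation $\Delta(x)=\sum x_1\otimes x_2$ is used. A \emph{$*$-Hopf algebra} is a Hopf algebra $H$ with a conjugate linear involution $*$ that is antimultiplicative and comultiplicative ($\Delta(x^*)=\sum x_1^*\otimes x_2^*$); its antipode $\mathcal S$ is then bijective. It is a \emph{compact quantum group} (CQG) if every right $H$-comodule $V$, with coaction $v\mapsto\sum v_0\otimes v_1$, admits an inner product (linear in the first variable) with $\sum\langle u_0,v\rangle\,\mathcal S(u_1)=\sum\langle u,v_0\rangle\,v_1^*$ for all $u,v\in V$; it is \emph{finite} if it is finite dimensional. A \emph{linked pair of bialgebras} $(A,H,\blacktriangleright,\rho)$ consists of bialgebras $A,H$ and linear maps $\blacktriangleright:H\otimes A\to A$, $\rho:H\to H\otimes A$, $\rho(x)=\sum x_H\otimes x_A$, such that $A$ is a left $H$-module algebra via $\blacktriangleright$, $H$ is a right $A$-comodule coalgebra via $\rho$ (that is, $\rho$ is a counital coassociative coaction, $\sum\varepsilon(x_H)x_A=\varepsilon(x)1$ and $\sum x_{H1}\otimes x_{H2}\otimes x_A=\sum x_{1H}\otimes x_{2H}\otimes x_{1A}x_{2A}$),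 and, for all $x,y\in H$, $a\in A$, \begin{align*} &\varepsilon(x\blacktriangleright a)=\varepsilon(x)\varepsilon(a),\qquad \rho(1)=1\otimes 1,\\ &\Delta(x\blacktriangleright a)=\sum (x_{1H}\blacktriangleright a_1)\otimes x_{1A}(x_2\blacktriangleright a_2),\\ &\rho(xy)=\sum x_{1H}\,y_H\otimes x_{1A}(x_2\blacktriangleright y_A),\\ &\sum x_{2H}\otimes (x_1\blacktriangleright a)x_{2A}=\sum x_{1H}\otimes x_{1A}(x_2\blacktriangleright a). \end{align*} When $A$ and $H$ are Hopf algebras, the bismash product $A\# H$ is the Hopf algebra with underlying space $A\otimes H$, elementary tensors $a\#x$, unit $1\#1$, counit $\varepsilon\otimes\varepsilon$, product $(a\#x)(b\#y)=\sum a(x_1\blacktriangleright b)\#x_2y$, coproduct $\Delta(a\#x)=\sum (a_1\#x_{1H})\otimes(a_2x_{1A}\#x_2)$ and antipode $\mathcal S(a\#x)=\sum(1\#\mathcal S(x_H))(\mathcal S(a x_A)\#1)$. \textbf{Statement.} Let $(A,H,\blacktriangleright,\rho)$ be a linked pair of bialgebras, where $A$ and $H$ are $*$-Hopf algebras. Then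 the formula $$(a\# x)^*=\sum x_1^*\blacktriangleright a^*\,\#\, x_2^*,\qquad a\in A,\ x\in H,$$ defines a structure of $*$-Hopf algebra on $A\# H$ if and only if $$(x\blacktriangleright a)^*=\mathcal S^{-1}(x^*)\blacktriangleright a^*\qquad\text{and}\qquad \rho(x^*)=\sum (x_{1H})^*\otimes\bigl(x_2^*\blacktriangleright (x_{1A})^*\bigr)$$ for all $a\in A$, $x\in H$. In this situation, if $A$ and $H$ are finite CQGs, then so is $A\# H$. -/

import Mathlib

open scoped TensorProduct Coalgebra ComplexConjugate
open Coalgebra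

universe u v w

noncomputable section

namespace QuantumLinkedPair

section Linked

variable (R : Type*) (A : Type u) (H : Type v) [CommRing R] [Ring A] [Ring H]
  [Bialgebra R A] [Bialgebra R H]

/-- A linked pair of bialgebras `(A, H, ▶, ρ)`: a cocycle linked pair whose cocycle and cococycle
are trivial. We write `x ▶ a = act x a` and `ρ x = coact x = ∑ x_H ⊗ x_A`; a sum over
`(ℛ R x).index` is the Sweedler sum `∑ x₁ ⊗ x₂ = Δ x`. -/
structure LinkedPair where
  /-- the action `x ⊗ a ↦ x ▶ a` -/
  act : H →ₗ[R] A →ₗ[R] A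
  /-- the coaction `ρ : H → H ⊗ A` -/
  coact : H →ₗ[R] H ⊗[R] A
  /-- `x ▶ 1 = ε(x) 1` -/
  act_one : ∀ x : H, act x 1 = algebraMap R A (counit x)
  /-- `x ▶ (a b) = ∑ (x₁ ▶ a) (x₂ ▶ b)` -/
  act_mul : ∀ (x : H) (a b : A), act x (a * b) =
    ∑ i ∈ (ℛ R x).index, act ((ℛ R x).left i) a * act ((ℛ R x).right i) b
  /-- `1 ▶ a = a` -/
  one_act : ∀ a : A, act 1 a = a
  /-- `(x y) ▶ a = x ▶ (y ▶ a)` -/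
  mul_act : ∀ (x y : H) (a : A), act (x * y) a = act x (act y a)
  /-- `∑ ε(x_H) x_A = ε(x) 1` -/
  counit_coact : ∀ x : H,
    TensorProduct.lid R A ((counit (R := R) (A := H)).rTensor A (coact x)) =
      algebraMap R A (counit x)
  /-- `∑ x_H₁ ⊗ x_H₂ ⊗ x_A = ∑ x₁_H ⊗ x₂_H ⊗ x₁_A x₂_A` -/
  comul_coact : ∀ x : H, (comul (R := R) (A := H)).rTensor A (coact x) =
    (LinearMap.mul' R A).lTensor (H ⊗[R] H)
      (TensorProduct.tensorTensorTensorComm R H A H A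
        (TensorProduct.map coact coact (comul x)))
  /-- `∑ x_H ε(x_A) = x` -/
  coact_counit : ∀ x : H,
    TensorProduct.rid R H ((counit (R := R) (A := A)).lTensor H (coact x)) = x
  /-- `∑ x_HH ⊗ x_HA ⊗ x_A = ∑ x_H ⊗ x_A₁ ⊗ x_A₂` -/
  coact_coact : ∀ x : H,
    TensorProduct.assoc R H A A (coact.rTensor A (coact x)) =
      (comul (R := R) (A := A)).lTensor H (coact x)
  /-- `ε(x ▶ a) = ε(x) ε(a)` -/
  counit_act : ∀ (x : H) (a : A),
    counit (R := R) (act x a) = counit (R := R) x * counit (R := R) a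
  /-- `ρ(1) = 1 ⊗ 1` -/
  coact_one : coact 1 = 1 ⊗ₜ[R] 1
  /-- `Δ(x ▶ a) = ∑ (x₁_H ▶ a₁) ⊗ x₁_A (x₂ ▶ a₂)` -/
  comul_act : ∀ (x : H) (a : A), comul (R := R) (act x a) =
    ∑ i ∈ (ℛ R x).index,
      TensorProduct.map₂ act (LinearMap.mul R A) (coact ((ℛ R x).left i))
        ((act ((ℛ R x).right i)).lTensor A (comul (R := R) a))
  /-- `∑ (x y)_H ⊗ (x y)_A = ∑ x₁_H y_H ⊗ x₁_A (x₂ ▶ y_A)`, a product in the algebra `H ⊗ A` -/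
  coact_mul : ∀ x y : H, coact (x * y) =
    ∑ i ∈ (ℛ R x).index,
      coact ((ℛ R x).left i) * (act ((ℛ R x).right i)).lTensor H (coact y)
  /-- `∑ x₂_H ⊗ (x₁ ▶ a) x₂_A = ∑ x₁_H ⊗ x₁_A (x₂ ▶ a)`, products in the algebra `H ⊗ A` -/
  act_coact_comm : ∀ (x : H) (a : A),
    ∑ i ∈ (ℛ R x).index, (1 ⊗ₜ[R] act ((ℛ R x).left i) a) * coact ((ℛ R x).right i) =
    ∑ i ∈ (ℛ R x).index, coact ((ℛ R x).left i) * (1 ⊗ₜ[R] act ((ℛ R x).right i) a)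

end Linked

/-- convolution product of linear maps from a coalgebra to an algebra -/
def cv {R C B : Type*} [CommSemiring R] [AddCommMonoid C] [Module R C] [Coalgebra R C] [Semiring B]
    [Algebra R B] (f g : C →ₗ[R] B) : C →ₗ[R] B :=
  LinearMap.mul' R B ∘ₗ TensorProduct.map f g ∘ₗ comul

section cv
variable {R C B B' : Type*} [CommSemiring R] [AddCommMonoid C] [Module R C] [Coalgebra R C] [Semiring B]
    [Algebra R B] [Semiring B'] [Algebra R B']

theorem cv_apply {ι : Type*} (f g : C →ₗ[R] B) (x : C) (r : Coalgebra.Repr R x ι) :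
    cv f g x = ∑ i ∈ r.index, f (r.left i) * g (r.right i) := by
  simp [cv, ← r.eq]

theorem cv_assoc (f g h : C →ₗ[R] B) : cv (cv f g) h = cv f (cv g h) :=
  congrArg WithConv.ofConv
    (mul_assoc (WithConv.toConv f) (WithConv.toConv g) (WithConv.toConv h))

theorem comp_cv (F : B →ₐ[R] B') (f g : C →ₗ[R] B) :
    F.toLinearMap ∘ₗ cv f g = cv (F.toLinearMap ∘ₗ f) (F.toLinearMap ∘ₗ g) := by
  ext x
  simp [cv_apply _ _ x (ℛ R x)]

theorem cv_mulRight (f g : C →ₗ[R] B) (b : B) :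
    LinearMap.mulRight R b ∘ₗ cv f g = cv f (LinearMap.mulRight R b ∘ₗ g) := by
  ext x
  simp [cv_apply _ _ x (ℛ R x), mul_assoc]

theorem mulLeft_cv (f g : C →ₗ[R] B) (b : B) :
    LinearMap.mulLeft R b ∘ₗ cv f g = cv (LinearMap.mulLeft R b ∘ₗ f) g := by
  ext x
  simp [cv_apply _ _ x (ℛ R x), mul_assoc]

theorem cv_sum {ι : Type*} (s : Finset ι) (f : ι → C →ₗ[R] B) (g : C →ₗ[R] B) :
    cv (∑ i ∈ s, f i) g = ∑ i ∈ s, cv (f i) g := by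
  ext x
  simp only [cv_apply _ _ x (ℛ R x), LinearMap.sum_apply, Finset.sum_mul]
  exact Finset.sum_comm

theorem cv_middle (f g : C →ₗ[R] B) (b : B) :
    cv (LinearMap.mulRight R b ∘ₗ f) g = cv f (LinearMap.mulLeft R b ∘ₗ g) := by
  ext x
  simp [cv_apply _ _ x (ℛ R x), mul_assoc]
theorem one_cv (f : C →ₗ[R] B) :
    cv (Algebra.linearMap R B ∘ₗ (counit (R := R) (A := C))) f = f :=
  congrArg WithConv.ofConv (one_mul (WithConv.toConv f))

theorem cv_one (f : C →ₗ[R] B) :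
    cv f (Algebra.linearMap R B ∘ₗ (counit (R := R) (A := C))) = f :=
  congrArg WithConv.ofConv (mul_one (WithConv.toConv f))

end cv

namespace LinkedPair

variable {R : Type*} {A : Type u} {H : Type v} [CommRing R] [Ring A] [Ring H]

section Bialg
variable [Bialgebra R A] [Bialgebra R H] (P : LinkedPair R A H)

/-- The vector space `A ⊗ H` underlying the bismash product `A # H` of a linked pair. -/
def Bismash (_P : LinkedPair R A H) : Type (max u v) := A ⊗[R] H

instance : AddCommGroup P.Bismash := inferInstanceAs (AddCommGroup (A ⊗[R] H))
instance : Module R P.Bismash := inferInstanceAs (Module R (A ⊗[R] H))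

/-- The elementary tensors `a # x` of `A # H`, as a bilinear map. -/
def tm : A →ₗ[R] H →ₗ[R] P.Bismash := TensorProduct.mk R A H

theorem hom_ext {M : Type*} [AddCommMonoid M] [Module R M] {f g : P.Bismash →ₗ[R] M}
    (h : ∀ a x, f (P.tm a x) = g (P.tm a x)) : f = g :=
  TensorProduct.ext' h

theorem induction_on {C : P.Bismash → Prop} (m : P.Bismash) (h : ∀ a x, C (P.tm a x))
    (h0 : C 0) (ha : ∀ m n, C m → C n → C (m + n)) : C m :=
  TensorProduct.induction_on m h0 h ha

/-- The linear map out of `A # H` given by a bilinear map. -/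
def liftB {M : Type*} [AddCommMonoid M] [Module R M] (f : A →ₗ[R] H →ₗ[R] M) :
    P.Bismash →ₗ[R] M := TensorProduct.lift f

@[simp] theorem liftB_tm {M : Type*} [AddCommMonoid M] [Module R M] (f : A →ₗ[R] H →ₗ[R] M)
    (a : A) (x : H) : P.liftB f (P.tm a x) = f a x := rfl

/-- The identity `A ⊗ H → A # H`. -/
def toB : A ⊗[R] H →ₗ[R] P.Bismash := LinearMap.id

@[simp] theorem toB_tmul (a : A) (x : H) : P.toB (a ⊗ₜ x) = P.tm a x := rfl

/-- `leftA a : b # y ↦ a b # y` -/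
def leftAAux : A →ₗ[R] A ⊗[R] H →ₗ[R] A ⊗[R] H :=
  LinearMap.rTensorHom H ∘ₗ LinearMap.mul R A

/-- `leftH x : b # y ↦ ∑ (x₁ ▶ b) # x₂ y` -/
def leftHAux : H →ₗ[R] A ⊗[R] H →ₗ[R] A ⊗[R] H :=
  TensorProduct.map₂ P.act (LinearMap.mul R H) ∘ₗ comul

/-- `leftAAux` on `A # H` -/
def leftA : A →ₗ[R] P.Bismash →ₗ[R] P.Bismash := leftAAux (R := R) (A := A) (H := H)
/-- `leftHAux` on `A # H` -/
def leftH : H →ₗ[R] P.Bismash →ₗ[R] P.Bismash := P.leftHAux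

@[simp] theorem leftA_tm (a b : A) (y : H) : P.leftA a (P.tm b y) = P.tm (a * b) y := rfl

theorem leftH_tm {ι : Type*} (x : H) (r : Coalgebra.Repr R x ι) (b : A) (y : H) :
    P.leftH x (P.tm b y) =
      ∑ i ∈ r.index, P.tm (P.act (r.left i) b) (r.right i * y) := by
  change TensorProduct.map₂ P.act (LinearMap.mul R H) (comul x) (b ⊗ₜ y) = _
  simp only [← r.eq, map_sum, LinearMap.sum_apply]
  rfl

/-- The multiplication of `A # H`: `(a # x) (b # y) = ∑ a (x₁ ▶ b) # x₂ y`. -/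
def mulB : P.Bismash →ₗ[R] P.Bismash →ₗ[R] P.Bismash :=
  P.liftB ((LinearMap.llcomp R P.Bismash P.Bismash P.Bismash).compl₁₂ P.leftA P.leftH)

theorem mulB_tm (a : A) (x : H) (m : P.Bismash) :
    P.mulB (P.tm a x) m = P.leftA a (P.leftH x m) := rfl

theorem leftA_mul (a b : A) (m : P.Bismash) : P.leftA (a * b) m = P.leftA a (P.leftA b m) := by
  induction m using P.induction_on with
  | h c z => simp [mul_assoc]
  | h0 => simp
  | ha m n hm hn => simp [hm, hn]

theorem leftA_one (m : P.Bismash) : P.leftA 1 m = m := by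
  induction m using P.induction_on with
  | h c z => simp
  | h0 => simp
  | ha m n hm hn => simp [hm, hn]

theorem leftH_one (m : P.Bismash) : P.leftH 1 m = m := by
  induction m using P.induction_on with
  | h c z =>
    rw [P.leftH_tm 1 ⟨{()}, fun _ => 1, fun _ => 1, by
      simp [Algebra.TensorProduct.one_def]⟩]
    simp [P.one_act]
  | h0 => simp
  | ha m n hm hn => rw [map_add, hm, hn]

theorem leftH_mul (x y : H) (m : P.Bismash) : P.leftH (x * y) m = P.leftH x (P.leftH y m) := by
  induction m using P.induction_on with
  | h c z =>
    rw [P.leftH_tm _ (Coalgebra.Repr.mul (ℛ R x) (ℛ R y)), P.leftH_tm _ (ℛ R y), map_sum]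
    simp only [P.leftH_tm x (ℛ R x)]
    rw [Finset.sum_comm]
    simp [Coalgebra.Repr.mul, Finset.sum_product, P.mul_act, mul_assoc]
  | h0 => simp
  | ha m n hm hn => simp [hm, hn]

/-- `(1 # x) (b # y)`: moving `x` past `b`. -/
theorem leftH_leftA {ι : Type*} (x : H) (r : Coalgebra.Repr R x ι) (b : A) (m : P.Bismash) :
    P.leftH x (P.leftA b m) =
      ∑ i ∈ r.index, P.leftA (P.act (r.left i) b) (P.leftH (r.right i) m) := by
  induction m using P.induction_on with
  | h c z =>
    have key := congrArg
      (P.toB ∘ₗ LinearMap.rTensor H (LinearMap.mul' R A) ∘ₗ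
        (TensorProduct.assoc R A A H).symm.toLinearMap ∘ₗ
        TensorProduct.map (P.act.flip b)
          (TensorProduct.map (P.act.flip c) (LinearMap.mulRight R z)))
      (Coalgebra.sum_tmul_tmul_eq r (fun i => ℛ R (r.left i)) (fun i => ℛ R (r.right i)))
    rw [leftA_tm, P.leftH_tm x r]
    simp only [P.act_mul, P.leftH_tm _ (ℛ R _), map_sum, leftA_tm, LinearMap.sum_apply]
    simpa using key
  | h0 => simp
  | ha m n hm hn => simp [hm, hn, Finset.sum_add_distrib]

theorem mulB_leftA (a : A) (m n : P.Bismash) :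
    P.mulB (P.leftA a m) n = P.leftA a (P.mulB m n) := by
  induction m using P.induction_on with
  | h b y => rw [leftA_tm, mulB_tm, mulB_tm, leftA_mul]
  | h0 => simp
  | ha m n hm hn => simp [hm, hn]

theorem mulB_leftH (x : H) (m n : P.Bismash) :
    P.mulB (P.leftH x m) n = P.leftH x (P.mulB m n) := by
  induction m using P.induction_on with
  | h b y =>
    rw [P.leftH_tm x (ℛ R x), mulB_tm, P.leftH_leftA x (ℛ R x)]
    simp [mulB_tm, P.leftH_mul]
  | h0 => simp
  | ha m n hm hn => simp [hm, hn]

instance : Mul P.Bismash := ⟨fun m n => P.mulB m n⟩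
instance : One P.Bismash := ⟨P.tm 1 1⟩

theorem mul_def (m n : P.Bismash) : m * n = P.mulB m n := rfl
theorem one_def : (1 : P.Bismash) = P.tm 1 1 := rfl

theorem mulB_assoc (l m n : P.Bismash) : P.mulB (P.mulB l m) n = P.mulB l (P.mulB m n) := by
  induction l using P.induction_on with
  | h a x => rw [mulB_tm, mulB_tm, mulB_leftA, mulB_leftH]
  | h0 => simp
  | ha m n hm hn => simp [hm, hn]

theorem leftH_tm_one (x : H) : P.leftH x (P.tm 1 1) = P.tm 1 x := by
  have key := congrArg (P.toB ∘ₗ TensorProduct.map (Algebra.linearMap R A) LinearMap.id)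
      (Coalgebra.sum_counit_tmul_eq (ℛ R x))
  rw [P.leftH_tm x (ℛ R x)]
  simp only [P.act_one, mul_one]
  simpa only [map_sum, LinearMap.comp_apply, TensorProduct.map_tmul, toB_tmul,
    Algebra.linearMap_apply, map_one, LinearMap.id_apply] using key

instance : Ring P.Bismash where
  __ := (inferInstance : AddCommGroup P.Bismash)
  mul_assoc := P.mulB_assoc
  one_mul m := by rw [mul_def, one_def, mulB_tm, leftH_one, leftA_one]
  mul_one m := by
    change P.mulB m (P.tm 1 1) = m
    induction m using P.induction_on with
    | h a x => rw [mulB_tm, P.leftH_tm_one, leftA_tm, mul_one]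
    | h0 => simp
    | ha m n hm hn => rw [map_add, LinearMap.add_apply, hm, hn]
  left_distrib l m n := map_add _ _ _
  right_distrib l m n := by simp only [mul_def, map_add, LinearMap.add_apply]
  zero_mul m := by simp only [mul_def, map_zero, LinearMap.zero_apply]
  mul_zero m := map_zero _

instance : Algebra R P.Bismash :=
  Algebra.ofModule (fun r m n => by simp only [mul_def, map_smul, LinearMap.smul_apply])
    (fun r m n => by simp only [mul_def, map_smul])

/-- `(a # x) (b # y) = ∑ a (x₁ ▶ b) # x₂ y` -/
theorem tm_mul_tm {ι : Type*} (a : A) (x : H) (r : Coalgebra.Repr R x ι) (b : A) (y : H) :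
    P.tm a x * P.tm b y =
      ∑ i ∈ r.index, P.tm (a * P.act (r.left i) b) (r.right i * y) := by
  rw [mul_def, mulB_tm, P.leftH_tm x r]
  simp

/-- `a ↦ a # 1` -/
def inA : A →ₐ[R] P.Bismash :=
  AlgHom.ofLinearMap (P.tm.flip 1) rfl fun a b => by
    change P.tm (a * b) 1 = P.leftA a (P.leftH 1 (P.tm b 1))
    rw [leftH_one, leftA_tm]

theorem tm_one_mul (x : H) (m : P.Bismash) : P.tm 1 x * m = P.leftH x m := by
  rw [mul_def, mulB_tm, leftA_one]

/-- `x ↦ 1 # x` -/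
def inH : H →ₐ[R] P.Bismash :=
  AlgHom.ofLinearMap (P.tm 1) rfl fun x y => by
    rw [tm_one_mul, ← P.leftH_tm_one y, ← P.leftH_tm_one (x * y), leftH_mul]

theorem inA_apply (a : A) : P.inA a = P.tm a 1 := rfl
theorem inH_apply (x : H) : P.inH x = P.tm 1 x := rfl

theorem inA_mul_inH (a : A) (x : H) : P.inA a * P.inH x = P.tm a x := by
  rw [inA_apply, inH_apply, mul_def, mulB_tm, leftH_one, leftA_tm, mul_one]

theorem inA_mul (a : A) (m : P.Bismash) : P.inA a * m = P.leftA a m := by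
  rw [inA_apply, mul_def, mulB_tm, leftH_one]

theorem inH_mul_inA (b : A) : LinearMap.mulRight R (P.inA b) ∘ₗ P.inH.toLinearMap =
    cv (P.inA.toLinearMap ∘ₗ P.act.flip b) P.inH.toLinearMap := by
  ext x
  simp only [cv_apply _ _ x (ℛ R x), LinearMap.comp_apply, AlgHom.toLinearMap_apply,
    LinearMap.mulRight_apply, inA_mul_inH, LinearMap.flip_apply]
  rw [inH_apply, inA_apply, P.tm_mul_tm _ _ (ℛ R x)]
  simp

/-- A linear map which agrees with `a # x ↦ α(a) β(x)` is multiplicative as soon as `α` and `β` are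
and satisfy the commutation rule of `A # H`. -/
theorem map_mul_of_comm {B : Type*} [Ring B] [Algebra R B] (f : P.Bismash →ₗ[R] B)
    (α : A →ₐ[R] B) (β : H →ₗ[R] B) (hβ : ∀ x y, β (x * y) = β x * β y)
    (hf : ∀ a x, f (P.tm a x) = α a * β x)
    (hc : ∀ b, LinearMap.mulRight R (α b) ∘ₗ β = cv (α.toLinearMap ∘ₗ P.act.flip b) β)
    (m n : P.Bismash) : f (m * n) = f m * f n := by
  induction m using P.induction_on with
  | h0 => simp
  | ha m n hm hn => simp [hm, hn, add_mul]
  | h a x =>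
    induction n using P.induction_on with
    | h0 => simp
    | ha m n hm hn => simp [hm, hn, mul_add]
    | h b y =>
      have h1 := LinearMap.congr_fun (hc b) x
      rw [cv_apply _ _ x (ℛ R x)] at h1
      simp only [LinearMap.comp_apply, LinearMap.mulRight_apply, AlgHom.toLinearMap_apply,
        LinearMap.flip_apply] at h1
      rw [P.tm_mul_tm _ _ (ℛ R x), map_sum]
      simp only [hf, map_mul, hβ]
      calc _ = α a * (∑ i ∈ (ℛ R x).index,
            α (P.act ((ℛ R x).left i) b) * β ((ℛ R x).right i)) * β y := by
            simp [Finset.mul_sum, Finset.sum_mul, mul_assoc]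
        _ = _ := by rw [← h1]; simp [mul_assoc]

/-- `x ↦ ∑ x₁_H ⊗ (x₁_A # x₂)` -/
def coactH : H →ₗ[R] H ⊗[R] P.Bismash :=
  P.toB.lTensor H ∘ₗ (TensorProduct.assoc R H A H).toLinearMap ∘ₗ P.coact.rTensor H ∘ₗ comul

/-- The comultiplication of `A # H`: `Δ(a # x) = ∑ (a₁ # x₁_H) ⊗ (a₂ x₁_A # x₂)`. -/
def comulB : P.Bismash →ₗ[R] P.Bismash ⊗[R] P.Bismash :=
  P.liftB ((TensorProduct.map₂ P.tm P.leftA).compl₁₂ comul P.coactH)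

/-- The counit of `A # H`: `ε(a # x) = ε(a) ε(x)`. -/
def counitB : P.Bismash →ₗ[R] R :=
  P.liftB ((LinearMap.mul R R).compl₁₂ counit counit)

instance : CoalgebraStruct R P.Bismash where
  comul := P.comulB
  counit := P.counitB

theorem counit_tm (a : A) (x : H) :
    counit (R := R) (P.tm a x) = counit (R := R) a * counit (R := R) x := rfl

/-- auxiliary algebra morphisms `a ⊗ b ↦ (a # 1) ⊗ (b # 1)`, `x ⊗ b ↦ (1 # x) ⊗ (b # 1)` and
`x ↦ 1 ⊗ (1 # x)`, and the map `x ↦ Δ(1 # x)` -/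
def jA : A ⊗[R] A →ₐ[R] P.Bismash ⊗[R] P.Bismash := Algebra.TensorProduct.map P.inA P.inA
def jK : H ⊗[R] A →ₐ[R] P.Bismash ⊗[R] P.Bismash := Algebra.TensorProduct.map P.inH P.inA
def jQ : H →ₐ[R] P.Bismash ⊗[R] P.Bismash :=
  Algebra.TensorProduct.includeRight.comp P.inH
def comulH : H →ₗ[R] P.Bismash ⊗[R] P.Bismash :=
  cv (P.jK.toLinearMap ∘ₗ P.coact) P.jQ.toLinearMap

theorem jA_tmul (a b : A) : P.jA (a ⊗ₜ b) = P.inA a ⊗ₜ P.inA b := rfl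
theorem jK_tmul (x : H) (b : A) : P.jK (x ⊗ₜ b) = P.inH x ⊗ₜ P.inA b := rfl
theorem jQ_apply (x : H) : P.jQ x = 1 ⊗ₜ P.inH x := rfl

theorem comul_tm (a : A) (x : H) :
    comul (R := R) (P.tm a x) = P.jA (comul a) * P.comulH x := by
  have key : ∀ (s : A ⊗[R] A) (t : H ⊗[R] A) (y : H),
      TensorProduct.map₂ P.tm P.leftA s
        (P.toB.lTensor H (TensorProduct.assoc R H A H (t ⊗ₜ y))) = P.jA s * (P.jK t * P.jQ y) := by
    intro s t y
    induction t with
    | zero => simp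
    | add t t' h h' => simp [TensorProduct.add_tmul, h, h', add_mul, mul_add]
    | tmul h b =>
      induction s with
      | zero => simp
      | add s s' h h' => simp only [map_add, LinearMap.add_apply, h, h', add_mul]
      | tmul c d =>
        simp only [jA_tmul, jK_tmul, jQ_apply, Algebra.TensorProduct.tmul_mul_tmul, mul_one,
          inA_mul_inH]
        rw [inA_mul]
        rfl
  change TensorProduct.map₂ P.tm P.leftA (comul a) (P.coactH x) = _
  rw [comulH, cv_apply _ _ x (ℛ R x), coactH]
  simp only [LinearMap.comp_apply]
  rw [← (ℛ R x).eq]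
  simp only [map_sum, LinearMap.rTensor_tmul, Finset.mul_sum]
  exact Finset.sum_congr rfl fun i _ => key _ _ _

theorem map_cv_coact {B B' : Type*} [Ring B] [Algebra R B] [Ring B'] [Algebra R B']
    (f g : H →ₗ[R] B) (α : A →ₐ[R] B') :
    TensorProduct.map (cv f g) α.toLinearMap ∘ₗ P.coact =
      cv (TensorProduct.map f α.toLinearMap ∘ₗ P.coact)
        (TensorProduct.map g α.toLinearMap ∘ₗ P.coact) := by
  ext x
  have h1 : ∀ t : H ⊗[R] A, TensorProduct.map (cv f g) α.toLinearMap t =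
      TensorProduct.map (LinearMap.mul' R B ∘ₗ TensorProduct.map f g) α.toLinearMap
        ((comul (R := R) (A := H)).rTensor A t) := by
    intro t
    induction t with
    | zero => simp
    | add s t hs ht => simp [hs, ht]
    | tmul h a => simp [cv]
  have h2 : ∀ t t' : H ⊗[R] A,
      TensorProduct.map (LinearMap.mul' R B ∘ₗ TensorProduct.map f g) α.toLinearMap
        ((LinearMap.mul' R A).lTensor (H ⊗[R] H)
          (TensorProduct.tensorTensorTensorComm R H A H A (t ⊗ₜ t'))) =
      TensorProduct.map f α.toLinearMap t * TensorProduct.map g α.toLinearMap t' := by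
    intro t t'
    induction t with
    | zero => simp
    | add s t hs ht => simp [TensorProduct.add_tmul, hs, ht, add_mul]
    | tmul h a =>
      induction t' with
      | zero => simp
      | add s t hs ht => simp [TensorProduct.tmul_add, hs, ht, mul_add]
      | tmul k b => simp
  rw [LinearMap.comp_apply, h1, P.comul_coact, cv_apply _ _ x (ℛ R x), ← (ℛ R x).eq]
  simp only [map_sum, TensorProduct.map_tmul, h2, LinearMap.comp_apply]

/-- `x ↦ ∑ t_H ⊗ (x ▶ t_A)` -/
def actR (t : H ⊗[R] A) : H →ₗ[R] H ⊗[R] A := (LinearMap.lTensorHom H ∘ₗ P.act).flip t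

theorem coact_mulRight (y : H) :
    P.coact ∘ₗ LinearMap.mulRight R y = cv P.coact (P.actR (P.coact y)) := by
  ext x
  simp only [LinearMap.comp_apply, LinearMap.mulRight_apply, P.coact_mul,
    cv_apply _ _ x (ℛ R x)]
  rfl

theorem inH_mul_inA_apply (x : H) (b : A) : P.inH x * P.inA b =
    ∑ i ∈ (ℛ R x).index, P.inA (P.act ((ℛ R x).left i) b) * P.inH ((ℛ R x).right i) := by
  have h := LinearMap.congr_fun (P.inH_mul_inA b) x
  rw [cv_apply _ _ x (ℛ R x)] at h
  exact h

theorem jQ_mul_jK (t : H ⊗[R] A) : LinearMap.mulRight R (P.jK t) ∘ₗ P.jQ.toLinearMap =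
    cv (P.jK.toLinearMap ∘ₗ P.actR t) P.jQ.toLinearMap := by
  ext x
  simp only [cv_apply _ _ x (ℛ R x), LinearMap.comp_apply, AlgHom.toLinearMap_apply,
    LinearMap.mulRight_apply]
  induction t with
  | zero => simp [actR]
  | add s t hs ht => simp [actR] at hs ht; simp [actR, hs, ht, mul_add, add_mul,
      Finset.sum_add_distrib]
  | tmul h a =>
    simp only [actR, LinearMap.flip_apply, LinearMap.comp_apply, LinearMap.coe_lTensorHom,
      LinearMap.lTensor_tmul, jK_tmul, jQ_apply, Algebra.TensorProduct.tmul_mul_tmul, one_mul,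
      mul_one, inH_mul_inA_apply, TensorProduct.tmul_sum]

theorem comulH_mul_jK (y : H) : LinearMap.mulRight R (P.jK (P.coact y)) ∘ₗ P.comulH =
    cv (P.jK.toLinearMap ∘ₗ P.coact ∘ₗ LinearMap.mulRight R y) P.jQ.toLinearMap := by
  rw [comulH, cv_mulRight, jQ_mul_jK, ← cv_assoc, coact_mulRight, comp_cv]

theorem comulH_mul (x y : H) : P.comulH (x * y) = P.comulH x * P.comulH y := by
  have h : ∀ j, P.comulH x * P.jK (P.coact ((ℛ R y).left j)) =
      ∑ i ∈ (ℛ R x).index,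
        P.jK (P.coact ((ℛ R x).left i * (ℛ R y).left j)) * P.jQ ((ℛ R x).right i) := by
    intro j
    have h := LinearMap.congr_fun (P.comulH_mul_jK ((ℛ R y).left j)) x
    rw [cv_apply _ _ x (ℛ R x)] at h
    exact h
  conv_rhs => rw [comulH, cv_apply _ _ y (ℛ R y), ← comulH]
  conv_lhs => rw [comulH, cv_apply _ _ _ (Coalgebra.Repr.mul (ℛ R x) (ℛ R y))]
  simp only [LinearMap.comp_apply, AlgHom.toLinearMap_apply, Finset.mul_sum, ← mul_assoc, h]
  simp [Coalgebra.Repr.mul, Finset.sum_product, Finset.sum_mul, map_mul, mul_assoc]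
  exact Finset.sum_comm

theorem jQ_mul_jA (b c : A) : LinearMap.mulRight R (P.jA (b ⊗ₜ c)) ∘ₗ P.jQ.toLinearMap =
    cv (LinearMap.mulLeft R (P.jA (b ⊗ₜ 1)) ∘ₗ P.jA.toLinearMap ∘ₗ TensorProduct.mk R A A 1 ∘ₗ
      P.act.flip c) P.jQ.toLinearMap := by
  ext x
  simp [cv_apply _ _ x (ℛ R x), jA_tmul, jQ_apply, inH_mul_inA_apply, TensorProduct.tmul_sum]

theorem jK_coact_mul_jA (b : A) :
    LinearMap.mulRight R (P.jA (b ⊗ₜ 1)) ∘ₗ P.jK.toLinearMap ∘ₗ P.coact =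
    cv (P.jA.toLinearMap ∘ₗ TensorProduct.map (P.act.flip b) LinearMap.id ∘ₗ P.coact)
      (P.jK.toLinearMap ∘ₗ P.coact) := by
  have h1 : LinearMap.mulRight R (P.jA (b ⊗ₜ 1)) ∘ₗ P.jK.toLinearMap =
      TensorProduct.map (LinearMap.mulRight R (P.inA b) ∘ₗ P.inH.toLinearMap)
        P.inA.toLinearMap := by
    ext h a
    simp [jA_tmul, jK_tmul]
  have h2 : P.jA.toLinearMap ∘ₗ TensorProduct.map (P.act.flip b) LinearMap.id =
      TensorProduct.map (P.inA.toLinearMap ∘ₗ P.act.flip b) P.inA.toLinearMap := by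
    ext h a
    simp [jA_tmul]
  rw [← LinearMap.comp_assoc, h1, inH_mul_inA, map_cv_coact, ← LinearMap.comp_assoc, h2]
  rfl

theorem comulH_mul_jA_tmul (b c : A) :
    LinearMap.mulRight R (P.jA (b ⊗ₜ c)) ∘ₗ P.comulH =
    cv (cv (P.jA.toLinearMap ∘ₗ TensorProduct.map (P.act.flip b) LinearMap.id ∘ₗ P.coact)
      (P.jA.toLinearMap ∘ₗ TensorProduct.mk R A A 1 ∘ₗ P.act.flip c)) P.comulH := by
  have h7 : cv (P.jK.toLinearMap ∘ₗ P.coact)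
        (P.jA.toLinearMap ∘ₗ TensorProduct.mk R A A 1 ∘ₗ P.act.flip c) =
      cv (P.jA.toLinearMap ∘ₗ TensorProduct.mk R A A 1 ∘ₗ P.act.flip c)
        (P.jK.toLinearMap ∘ₗ P.coact) := by
    have e : P.jA.toLinearMap ∘ₗ TensorProduct.mk R A A 1 ∘ₗ P.act.flip c =
        P.jK.toLinearMap ∘ₗ TensorProduct.mk R H A 1 ∘ₗ P.act.flip c := by
      ext x
      simp [jA_tmul, jK_tmul]
    rw [e, ← comp_cv, ← comp_cv]
    congr 1
    ext x
    rw [cv_apply _ _ x (ℛ R x), cv_apply _ _ x (ℛ R x)]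
    exact (P.act_coact_comm x c).symm
  rw [comulH, cv_mulRight, jQ_mul_jA, ← cv_assoc, ← cv_middle, jK_coact_mul_jA, cv_assoc _ _ (_ ∘ₗ _),
    h7, ← cv_assoc, cv_assoc]

theorem comulH_mul_jA (b : A) :
    LinearMap.mulRight R (P.jA (comul b)) ∘ₗ P.comulH =
    cv (P.jA.toLinearMap ∘ₗ comul ∘ₗ P.act.flip b) P.comulH := by
  have key : ∀ (t : H ⊗[R] A) (b c : A), TensorProduct.map₂ P.act (LinearMap.mul R A) t (b ⊗ₜ c) =
      TensorProduct.map (P.act.flip b) LinearMap.id t * (1 ⊗ₜ c) := by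
    intro t b c
    induction t with
    | zero => simp
    | add s t hs ht => simp only [map_add, LinearMap.add_apply, hs, ht, add_mul]
    | tmul h a => simp [TensorProduct.map₂_apply_tmul]
  have h5 : P.jA.toLinearMap ∘ₗ comul ∘ₗ P.act.flip b = ∑ l ∈ (ℛ R b).index,
      cv (P.jA.toLinearMap ∘ₗ TensorProduct.map (P.act.flip ((ℛ R b).left l)) LinearMap.id ∘ₗ
        P.coact)
      (P.jA.toLinearMap ∘ₗ TensorProduct.mk R A A 1 ∘ₗ P.act.flip ((ℛ R b).right l)) := by
    ext x
    simp only [LinearMap.comp_apply, LinearMap.flip_apply, LinearMap.sum_apply,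
      cv_apply _ _ x (ℛ R x), P.comul_act]
    rw [← (ℛ R b).eq, Finset.sum_comm]
    simp only [map_sum, LinearMap.lTensor_tmul, key, AlgHom.toLinearMap_apply, map_mul,
      TensorProduct.mk_apply]
  rw [h5, cv_sum]
  simp only [← comulH_mul_jA_tmul]
  rw [← (ℛ R b).eq]
  ext x
  simp [Finset.mul_sum]

theorem comulH_one : P.comulH 1 = 1 := by
  rw [comulH, cv_apply _ _ 1 ⟨{()}, fun _ => 1, fun _ => 1, by
      simp [Algebra.TensorProduct.one_def]⟩]
  simp [P.coact_one, jK_tmul, Algebra.TensorProduct.one_def]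

theorem tm_one_one : P.tm 1 1 = 1 := rfl

/-- The comultiplication of `A # H` as an algebra morphism. -/
def comulHom : P.Bismash →ₐ[R] P.Bismash ⊗[R] P.Bismash :=
  AlgHom.ofLinearMap comul
    (by rw [← tm_one_one, comul_tm, comulH_one]; simp [Algebra.TensorProduct.one_def, jA_tmul])
    (P.map_mul_of_comm comul (P.jA.comp (Bialgebra.comulAlgHom R A)) P.comulH P.comulH_mul
      P.comul_tm P.comulH_mul_jA)

theorem comulHom_toLinearMap : P.comulHom.toLinearMap = comul := rfl

/-- The counit of `A # H` as an algebra morphism. -/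
def counitHom : P.Bismash →ₐ[R] R :=
  AlgHom.ofLinearMap counit
    (by rw [← tm_one_one, counit_tm]; simp)
    (P.map_mul_of_comm counit (Bialgebra.counitAlgHom R A) counit Bialgebra.counit_mul
      P.counit_tm (fun b => by
        ext x
        have h := congrArg (LinearMap.mul' R R ∘ₗ TensorProduct.map LinearMap.id counit)
          (Coalgebra.sum_counit_tmul_eq (ℛ R x))
        simp only [cv_apply _ _ x (ℛ R x), LinearMap.comp_apply, LinearMap.mulRight_apply,
          AlgHom.toLinearMap_apply, LinearMap.flip_apply, Bialgebra.counitAlgHom_apply,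
          P.counit_act]
        simp only [map_sum, LinearMap.comp_apply, TensorProduct.map_tmul, LinearMap.id_apply,
          LinearMap.mul'_apply, one_mul] at h
        rw [← h, Finset.sum_mul]
        exact Finset.sum_congr rfl fun i _ => by ring))

theorem algHom_ext {B : Type*} [Semiring B] [Algebra R B] {f g : P.Bismash →ₐ[R] B}
    (hA : ∀ a, f (P.inA a) = g (P.inA a)) (hH : ∀ x, f (P.inH x) = g (P.inH x)) : f = g := by
  apply AlgHom.toLinearMap_injective
  refine P.hom_ext fun a x => ?_
  simp only [AlgHom.toLinearMap_apply, ← inA_mul_inH, map_mul, hA, hH]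

theorem comulHom_inA (a : A) : P.comulHom (P.inA a) = P.jA (comul a) := by
  refine (P.comul_tm a 1).trans ?_
  rw [comulH_one, mul_one]

theorem comulHom_inH (x : H) : P.comulHom (P.inH x) = P.comulH x := by
  refine (P.comul_tm 1 x).trans ?_
  simp

theorem counitHom_inA (a : A) : P.counitHom (P.inA a) = counit (R := R) a :=
  (P.counit_tm a 1).trans (by rw [Bialgebra.counit_one, mul_one])

theorem counitHom_inH (x : H) : P.counitHom (P.inH x) = counit (R := R) x :=
  (P.counit_tm 1 x).trans (by rw [Bialgebra.counit_one, one_mul])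

def jE : P.Bismash ⊗[R] P.Bismash →ₐ[R] P.Bismash ⊗[R] (P.Bismash ⊗[R] P.Bismash) :=
  Algebra.TensorProduct.includeRight

def jF₁ : P.Bismash ⊗[R] P.Bismash →ₐ[R] P.Bismash ⊗[R] (P.Bismash ⊗[R] P.Bismash) :=
  (Algebra.TensorProduct.assoc R R R P.Bismash P.Bismash P.Bismash).toAlgHom.comp
    (Algebra.TensorProduct.map P.comulHom (AlgHom.id R P.Bismash))

def jF₂ : P.Bismash ⊗[R] P.Bismash →ₐ[R] P.Bismash ⊗[R] (P.Bismash ⊗[R] P.Bismash) :=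
  Algebra.TensorProduct.map (AlgHom.id R P.Bismash) P.comulHom

theorem jF₁_tmul (m n : P.Bismash) : P.jF₁ (m ⊗ₜ n) =
    TensorProduct.assoc R P.Bismash P.Bismash P.Bismash (P.comulHom m ⊗ₜ n) := rfl
theorem jF₂_tmul (m n : P.Bismash) : P.jF₂ (m ⊗ₜ n) = m ⊗ₜ P.comulHom n := rfl

theorem coassoc_inA (a : A) : P.jF₁ (P.jA (comul a)) = P.jF₂ (P.jA (comul a)) := by
  have h1 : ∀ s : A ⊗[R] A, P.jF₁ (P.jA s) =
      TensorProduct.map P.inA.toLinearMap (TensorProduct.map P.inA.toLinearMap P.inA.toLinearMap)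
        (TensorProduct.assoc R A A A ((comul (R := R) (A := A)).rTensor A s)) := by
    intro s
    induction s with
    | zero => simp
    | add s t hs ht => simp only [map_add, hs, ht]
    | tmul b c =>
      rw [jA_tmul, jF₁_tmul, comulHom_inA, LinearMap.rTensor_tmul]
      induction comul (R := R) b with
      | zero => simp
      | add s t hs ht => simp only [map_add, TensorProduct.add_tmul, hs, ht]
      | tmul d e => rfl
  have h2 : ∀ s : A ⊗[R] A, P.jF₂ (P.jA s) =
      TensorProduct.map P.inA.toLinearMap (TensorProduct.map P.inA.toLinearMap P.inA.toLinearMap)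
        ((comul (R := R) (A := A)).lTensor A s) := by
    intro s
    induction s with
    | zero => simp
    | add s t hs ht => simp only [map_add, hs, ht]
    | tmul b c =>
      rw [jA_tmul, jF₂_tmul, comulHom_inA, LinearMap.lTensor_tmul]
      rfl
  rw [h1, h2, Coalgebra.coassoc_apply]

theorem coassoc_inH (x : H) : P.jF₁ (P.comulH x) = P.jF₂ (P.comulH x) := by
  let W : H →ₗ[R] P.Bismash ⊗[R] (P.Bismash ⊗[R] P.Bismash) :=
    TensorProduct.map P.inH.toLinearMap (P.jA.toLinearMap ∘ₗ comul) ∘ₗ P.coact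
  let al : (P.Bismash ⊗[R] P.Bismash) ⊗[R] P.Bismash →ₐ[R]
      P.Bismash ⊗[R] (P.Bismash ⊗[R] P.Bismash) :=
    (Algebra.TensorProduct.assoc R R R P.Bismash P.Bismash P.Bismash).toAlgHom
  have a1 : P.jF₁.toLinearMap ∘ₗ P.jK.toLinearMap =
      al.toLinearMap ∘ₗ TensorProduct.map P.comulH P.inA.toLinearMap := by
    ext h a
    simp only [TensorProduct.AlgebraTensorModule.curry_apply, TensorProduct.curry_apply,
      LinearMap.coe_restrictScalars, LinearMap.comp_apply, AlgHom.toLinearMap_apply,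
      jK_tmul, jF₁_tmul, comulHom_inH, TensorProduct.map_tmul]
    rfl
  have a2 : (al.toLinearMap ∘ₗ TensorProduct.map (P.jK.toLinearMap ∘ₗ P.coact)
      P.inA.toLinearMap) ∘ₗ P.coact = W := by
    have h : ∀ t : H ⊗[R] A, al (TensorProduct.map (P.jK.toLinearMap ∘ₗ P.coact)
          P.inA.toLinearMap t) =
        TensorProduct.map P.inH.toLinearMap P.jA.toLinearMap
          (TensorProduct.assoc R H A A (P.coact.rTensor A t)) := by
      intro t
      induction t with
      | zero => simp
      | add s t hs ht => simp only [map_add, hs, ht]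
      | tmul h a =>
        rw [TensorProduct.map_tmul, LinearMap.rTensor_tmul, LinearMap.comp_apply]
        induction P.coact h with
        | zero => simp
        | add s t hs ht => simp only [map_add, TensorProduct.add_tmul, hs, ht]
        | tmul d e => rfl
    ext y
    simp only [LinearMap.comp_apply, AlgHom.toLinearMap_apply, h, P.coact_coact, W]
    rw [← LinearMap.comp_apply, LinearMap.map_comp_lTensor]
  have a3 : al.toLinearMap ∘ₗ TensorProduct.map P.jQ.toLinearMap P.inA.toLinearMap =
      P.jE.toLinearMap ∘ₗ P.jK.toLinearMap := by
    ext h a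
    rfl
  have a4 : P.jF₁.toLinearMap ∘ₗ P.jQ.toLinearMap = P.jE.toLinearMap ∘ₗ P.jQ.toLinearMap := by
    ext h
    simp only [LinearMap.comp_apply, AlgHom.toLinearMap_apply, jQ_apply, jF₁_tmul, map_one]
    rfl
  have b1 : P.jF₂.toLinearMap ∘ₗ P.jK.toLinearMap ∘ₗ P.coact = W := by
    have h : P.jF₂.toLinearMap ∘ₗ P.jK.toLinearMap =
        TensorProduct.map P.inH.toLinearMap (P.jA.toLinearMap ∘ₗ comul) := by
      ext h a
      simp only [TensorProduct.AlgebraTensorModule.curry_apply, TensorProduct.curry_apply,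
        LinearMap.coe_restrictScalars, LinearMap.comp_apply, AlgHom.toLinearMap_apply,
        jK_tmul, jF₂_tmul, comulHom_inA, TensorProduct.map_tmul]
    rw [← LinearMap.comp_assoc, h]
  have b2 : P.jF₂.toLinearMap ∘ₗ P.jQ.toLinearMap = P.jE.toLinearMap ∘ₗ P.comulH := by
    ext h
    simp only [LinearMap.comp_apply, AlgHom.toLinearMap_apply, jQ_apply, jF₂_tmul, comulHom_inH]
    rfl
  have e1 : P.jF₁.toLinearMap ∘ₗ P.comulH = P.jF₂.toLinearMap ∘ₗ P.comulH := by
    have l : P.jF₁.toLinearMap ∘ₗ P.comulH = cv (cv W (P.jE.toLinearMap ∘ₗ P.jK.toLinearMap ∘ₗ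
        P.coact)) (P.jE.toLinearMap ∘ₗ P.jQ.toLinearMap) := by
      conv_lhs => rw [comulH, comp_cv, a4, ← LinearMap.comp_assoc, a1, comulH,
        LinearMap.comp_assoc, map_cv_coact, comp_cv, ← LinearMap.comp_assoc, a2,
        ← LinearMap.comp_assoc, a3, LinearMap.comp_assoc]
    have r : P.jF₂.toLinearMap ∘ₗ P.comulH = cv W (cv (P.jE.toLinearMap ∘ₗ P.jK.toLinearMap ∘ₗ
        P.coact) (P.jE.toLinearMap ∘ₗ P.jQ.toLinearMap)) := by
      conv_lhs => rw [comulH, comp_cv, b1, b2, comulH, comp_cv]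
    rw [l, r, cv_assoc]
  exact LinearMap.congr_fun e1 x

theorem coassoc_alg : P.jF₁.comp P.comulHom = P.jF₂.comp P.comulHom := by
  refine P.algHom_ext (fun a => ?_) (fun x => ?_)
  · simp only [AlgHom.comp_apply, comulHom_inA, coassoc_inA]
  · simp only [AlgHom.comp_apply, comulHom_inH, coassoc_inH]

def jG₁ : P.Bismash ⊗[R] P.Bismash →ₐ[R] P.Bismash :=
  (Algebra.TensorProduct.lid R P.Bismash).toAlgHom.comp
    (Algebra.TensorProduct.map P.counitHom (AlgHom.id R P.Bismash))

def jG₂ : P.Bismash ⊗[R] P.Bismash →ₐ[R] P.Bismash :=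
  (Algebra.TensorProduct.rid R R P.Bismash).toAlgHom.comp
    (Algebra.TensorProduct.map (AlgHom.id R P.Bismash) P.counitHom)

theorem jG₁_tmul (m n : P.Bismash) : P.jG₁ (m ⊗ₜ n) = P.counitHom m • n := rfl
theorem jG₂_tmul (m n : P.Bismash) : P.jG₂ (m ⊗ₜ n) = P.counitHom n • m := rfl

theorem counit_left : P.jG₁.comp P.comulHom = AlgHom.id R P.Bismash := by
  refine P.algHom_ext (fun a => ?_) (fun x => ?_)
  · have h := congrArg (P.inA ∘ TensorProduct.lid R A) (Coalgebra.sum_counit_tmul_eq (ℛ R a))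
    simp only [AlgHom.comp_apply, comulHom_inA, ← (ℛ R a).eq, map_sum, jA_tmul, jG₁_tmul,
      counitHom_inA]
    simpa only [Function.comp_apply, map_sum, TensorProduct.lid_tmul, map_smul, one_smul,
      AlgHom.id_apply] using h
  · have h1 : P.jG₁.toLinearMap ∘ₗ P.jK.toLinearMap ∘ₗ P.coact =
        Algebra.linearMap R P.Bismash ∘ₗ counit := by
      ext y
      have h : ∀ t : H ⊗[R] A, P.jG₁ (P.jK t) =
          P.inA (TensorProduct.lid R A ((counit (R := R) (A := H)).rTensor A t)) := by
        intro t
        induction t with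
        | zero => simp
        | add s t hs ht => simp only [map_add, hs, ht]
        | tmul h a => simp [jK_tmul, jG₁_tmul, counitHom_inH]
      simp only [LinearMap.comp_apply, AlgHom.toLinearMap_apply, h, P.counit_coact,
        AlgHom.commutes, Algebra.linearMap_apply]
    have h2 : P.jG₁.toLinearMap ∘ₗ P.jQ.toLinearMap = P.inH.toLinearMap := by
      ext y
      simp [jQ_apply, jG₁_tmul]
    have h3 : P.jG₁.toLinearMap ∘ₗ P.comulH = P.inH.toLinearMap := by
      rw [comulH, comp_cv, h1, h2, one_cv]
    rw [AlgHom.comp_apply, comulHom_inH]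
    exact LinearMap.congr_fun h3 x

theorem counit_right : P.jG₂.comp P.comulHom = AlgHom.id R P.Bismash := by
  refine P.algHom_ext (fun a => ?_) (fun x => ?_)
  · have h := congrArg (P.inA ∘ TensorProduct.rid R A) (Coalgebra.sum_tmul_counit_eq (ℛ R a))
    simp only [AlgHom.comp_apply, comulHom_inA, ← (ℛ R a).eq, map_sum, jA_tmul, jG₂_tmul,
      counitHom_inA]
    simpa only [Function.comp_apply, map_sum, TensorProduct.rid_tmul, map_smul, one_smul,
      AlgHom.id_apply] using h
  · have h1 : P.jG₂.toLinearMap ∘ₗ P.jK.toLinearMap ∘ₗ P.coact = P.inH.toLinearMap := by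
      ext y
      have h : ∀ t : H ⊗[R] A, P.jG₂ (P.jK t) =
          P.inH (TensorProduct.rid R H ((counit (R := R) (A := A)).lTensor H t)) := by
        intro t
        induction t with
        | zero => simp
        | add s t hs ht => simp only [map_add, hs, ht]
        | tmul h a => simp [jK_tmul, jG₂_tmul, counitHom_inA]
      simp only [LinearMap.comp_apply, AlgHom.toLinearMap_apply, h, P.coact_counit]
    have h2 : P.jG₂.toLinearMap ∘ₗ P.jQ.toLinearMap =
        Algebra.linearMap R P.Bismash ∘ₗ counit := by
      ext y
      simp [jQ_apply, jG₂_tmul, counitHom_inH, Algebra.algebraMap_eq_smul_one]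
    have h3 : P.jG₂.toLinearMap ∘ₗ P.comulH = P.inH.toLinearMap := by
      rw [comulH, comp_cv, h1, h2, cv_one]
    rw [AlgHom.comp_apply, comulHom_inH]
    exact LinearMap.congr_fun h3 x

instance : Coalgebra R P.Bismash where
  coassoc := congrArg AlgHom.toLinearMap P.coassoc_alg
  rTensor_counit_comp_comul := by
    ext m : 1
    apply (TensorProduct.lid R P.Bismash).injective
    have h := AlgHom.congr_fun P.counit_left m
    simp only [LinearMap.comp_apply, TensorProduct.mk_apply, TensorProduct.lid_tmul, one_smul]
    exact h
  lTensor_counit_comp_comul := by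
    ext m : 1
    apply (TensorProduct.rid R P.Bismash).injective
    have h := AlgHom.congr_fun P.counit_right m
    simp only [LinearMap.comp_apply, LinearMap.flip_apply, TensorProduct.mk_apply,
      TensorProduct.rid_tmul, one_smul]
    exact h

instance : Bialgebra R P.Bismash :=
  Bialgebra.mk' R P.Bismash (map_one P.counitHom) (map_mul P.counitHom _ _)
    (map_one P.comulHom) (map_mul P.comulHom _ _)

end Bialg

section Hopf
variable [HopfAlgebra R A] [HopfAlgebra R H] (P : LinkedPair R A H)
open HopfAlgebra

/-- The antipode of `A # H`: `S(a # x) = ∑ (1 # S(x_H)) (S(a x_A) # 1)`. -/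
def antipodeB : P.Bismash →ₗ[R] P.Bismash :=
  P.liftB (((LinearMap.lTensorHom H ∘ₗ LinearMap.mul R A).compl₂ P.coact).compr₂
    (LinearMap.mul' R P.Bismash ∘ₗ
      TensorProduct.map (P.inH.toLinearMap ∘ₗ antipode R) (P.inA.toLinearMap ∘ₗ antipode R)))

/-- `x ↦ ∑ (1 # S(x_H)) (S(x_A) # 1)` -/
def antipodeH : H →ₗ[R] P.Bismash :=
  (LinearMap.mul' R P.Bismash ∘ₗ
      TensorProduct.map (P.inH.toLinearMap ∘ₗ antipode R) (P.inA.toLinearMap ∘ₗ antipode R)) ∘ₗ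
    P.coact

theorem antipodeB_tm (a : A) (x : H) :
    P.antipodeB (P.tm a x) = P.antipodeH x * P.inA (antipode R a) := by
  change (LinearMap.mul' R P.Bismash)
      (TensorProduct.map (P.inH.toLinearMap ∘ₗ antipode R) (P.inA.toLinearMap ∘ₗ antipode R)
        ((LinearMap.mul R A a).lTensor H (P.coact x))) = (LinearMap.mul' R P.Bismash)
      (TensorProduct.map (P.inH.toLinearMap ∘ₗ antipode R) (P.inA.toLinearMap ∘ₗ antipode R)
        (P.coact x)) * _
  induction P.coact x with
  | zero => simp
  | add s t hs ht => simp only [map_add, hs, ht, add_mul]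
  | tmul h b => simp [antipode_mul_antidistrib, mul_assoc]

theorem antipodeB_inA_mul (a : A) (m : P.Bismash) :
    P.antipodeB (P.inA a * m) = P.antipodeB m * P.inA (antipode R a) := by
  induction m using P.induction_on with
  | h b x =>
    rw [inA_mul, leftA_tm, antipodeB_tm, antipodeB_tm, antipode_mul_antidistrib, map_mul,
      mul_assoc]
  | h0 => simp
  | ha m n hm hn => simp only [mul_add, map_add, hm, hn, add_mul]

theorem antipodeB_inH (x : H) : P.antipodeB (P.inH x) = P.antipodeH x := by
  rw [inH_apply, antipodeB_tm, antipode_one, map_one, mul_one]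

theorem antipodeH_coact (x : H) :
    LinearMap.mul' R P.Bismash (TensorProduct.map P.antipodeH P.inA.toLinearMap (P.coact x)) =
      P.inH (antipode R x) := by
  let F : H ⊗[R] (A ⊗[R] A) →ₗ[R] P.Bismash :=
    LinearMap.mul' R P.Bismash ∘ₗ TensorProduct.map (P.inH.toLinearMap ∘ₗ antipode R)
      (P.inA.toLinearMap ∘ₗ LinearMap.mul' R A ∘ₗ (antipode R).rTensor A)
  have h1 : ∀ t : H ⊗[R] A,
      LinearMap.mul' R P.Bismash (TensorProduct.map P.antipodeH P.inA.toLinearMap t) =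
        F (TensorProduct.assoc R H A A (P.coact.rTensor A t)) := by
    intro t
    induction t with
    | zero => simp
    | add s t hs ht => simp only [map_add, hs, ht]
    | tmul h a =>
      rw [TensorProduct.map_tmul, LinearMap.rTensor_tmul, antipodeH, LinearMap.comp_apply]
      induction P.coact h with
      | zero => simp
      | add s t hs ht =>
        simp only [map_add, TensorProduct.add_tmul, hs, ht]
      | tmul d e => simp [F, mul_assoc]
  have h2 : ∀ t : H ⊗[R] A, F ((comul (R := R) (A := A)).lTensor H t) =
      P.inH (antipode R (TensorProduct.rid R H ((counit (R := R) (A := A)).lTensor H t))) := by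
    intro t
    induction t with
    | zero => simp
    | add s t hs ht => simp only [map_add, hs, ht]
    | tmul h a =>
      simp [F, mul_antipode_rTensor_comul_apply, Algebra.algebraMap_eq_smul_one]
  rw [h1, P.coact_coact, h2, P.coact_counit]

theorem mul_antipode_left (a : A) (x : H) :
    LinearMap.mul' R P.Bismash (P.antipodeB.rTensor P.Bismash (comul (P.tm a x))) =
      algebraMap R P.Bismash (counit (P.tm a x)) := by
  have h1 : ∀ (s : A ⊗[R] A) (t : H ⊗[R] A) (y : H),
      LinearMap.mul' R P.Bismash (P.antipodeB.rTensor P.Bismash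
        (P.jA s * (P.jK t * P.jQ y))) =
      LinearMap.mul' R P.Bismash (TensorProduct.map P.antipodeH
        (LinearMap.mulLeft R (P.inA (LinearMap.mul' R A ((antipode R).rTensor A s))) ∘ₗ
          P.inA.toLinearMap) t) * P.inH y := by
    intro s t y
    induction t with
    | zero => simp
    | add t t' h h' => simp only [map_add, add_mul, mul_add, h, h']
    | tmul h b =>
      induction s with
      | zero => simp
      | add s s' h h' =>
        simp only [map_add, add_mul, h, h', TensorProduct.map_tmul, LinearMap.comp_apply,
          LinearMap.mulLeft_apply, LinearMap.mul'_apply, mul_add]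
      | tmul c d =>
        simp [jA_tmul, jK_tmul, jQ_apply, antipodeB_inA_mul, antipodeB_inH, mul_assoc]
  rw [comul_tm, comulH, cv_apply _ _ x (ℛ R x), Finset.mul_sum]
  have h0 : P.inA (counit (R := R) a • 1) = counit (R := R) a • (1 : P.Bismash) := by
    rw [map_smul, map_one]
  simp only [map_sum, LinearMap.comp_apply, AlgHom.toLinearMap_apply, h1,
    mul_antipode_rTensor_comul_apply, Algebra.algebraMap_eq_smul_one, h0]
  have h2 : ∀ t : H ⊗[R] A, LinearMap.mul' R P.Bismash (TensorProduct.map P.antipodeH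
      (LinearMap.mulLeft R (counit (R := R) a • (1 : P.Bismash)) ∘ₗ P.inA.toLinearMap) t) =
      counit (R := R) a • LinearMap.mul' R P.Bismash
        (TensorProduct.map P.antipodeH P.inA.toLinearMap t) := by
    intro t
    induction t with
    | zero => simp
    | add t t' h h' => simp only [map_add, smul_add, h, h']
    | tmul h b => simp
  simp only [h2, antipodeH_coact, smul_mul_assoc, ← map_mul, ← Finset.smul_sum, ← map_sum,
    sum_antipode_mul_eq_algebraMap_counit, counit_tm, mul_smul, AlgHom.commutes]
  rw [Algebra.algebraMap_eq_smul_one]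

theorem inH_antipodeH (x : H) (r : Coalgebra.Repr R x (H × H)) :
    ∑ i ∈ r.index, LinearMap.mul' R P.Bismash (P.antipodeB.lTensor P.Bismash
      (P.jK (P.coact (r.left i)) * P.jQ (r.right i))) =
      algebraMap R P.Bismash (counit x) := by
  let F : (H ⊗[R] H) ⊗[R] A →ₗ[R] P.Bismash :=
    LinearMap.mul' R P.Bismash ∘ₗ
      TensorProduct.map (P.inH.toLinearMap ∘ₗ LinearMap.mul' R H ∘ₗ (antipode R).lTensor H)
      (P.inA.toLinearMap ∘ₗ antipode R)
  have h1 : ∀ (t : H ⊗[R] A) (y : H), LinearMap.mul' R P.Bismash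
      (P.antipodeB.lTensor P.Bismash (P.jK t * P.jQ y)) =
      F ((LinearMap.mul' R A).lTensor (H ⊗[R] H)
          (TensorProduct.tensorTensorTensorComm R H A H A (t ⊗ₜ P.coact y))) := by
    intro t y
    induction t with
    | zero => simp
    | add t t' h h' => simp only [map_add, add_mul, TensorProduct.add_tmul, h, h']
    | tmul h b =>
      rw [jK_tmul, jQ_apply, Algebra.TensorProduct.tmul_mul_tmul, mul_one,
        LinearMap.lTensor_tmul, antipodeB_inA_mul, antipodeB_inH, antipodeH,
        LinearMap.comp_apply]
      induction P.coact y with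
      | zero => simp
      | add t t' h h' =>
        simp only [LinearMap.mul'_apply, map_add, TensorProduct.tmul_add, add_mul] at *
        rw [← h, ← h', ← mul_add, ← add_mul]
      | tmul k c => simp [F, antipode_mul_antidistrib, mul_assoc]
  have h2 : ∀ t : H ⊗[R] A, F ((comul (R := R) (A := H)).rTensor A t) =
      P.inA (antipode R (TensorProduct.lid R A ((counit (R := R) (A := H)).rTensor A t))) := by
    intro t
    induction t with
    | zero => simp
    | add s t hs ht => simp only [map_add, hs, ht]
    | tmul h a =>
      simp [F, mul_antipode_lTensor_comul_apply, Algebra.algebraMap_eq_smul_one]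
  have h3 := P.comul_coact x
  rw [← r.eq] at h3
  simp only [map_sum, TensorProduct.map_tmul] at h3
  simp only [h1, ← map_sum F]
  rw [← h3, h2, P.counit_coact, Algebra.algebraMap_eq_smul_one, map_smul, antipode_one, map_smul,
    map_one, Algebra.algebraMap_eq_smul_one]

theorem mul_antipode_right (a : A) (x : H) :
    LinearMap.mul' R P.Bismash (P.antipodeB.lTensor P.Bismash (comul (P.tm a x))) =
      algebraMap R P.Bismash (counit (P.tm a x)) := by
  have h1 : ∀ (b c : A) (w : P.Bismash ⊗[R] P.Bismash),
      LinearMap.mul' R P.Bismash (P.antipodeB.lTensor P.Bismash (P.jA (b ⊗ₜ c) * w)) =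
      P.inA b * LinearMap.mul' R P.Bismash (P.antipodeB.lTensor P.Bismash w) *
        P.inA (antipode R c) := by
    intro b c w
    induction w with
    | zero => simp
    | add t t' h h' => simp only [map_add, add_mul, mul_add, h, h']
    | tmul m n => simp [jA_tmul, antipodeB_inA_mul, mul_assoc]
  have h2 : LinearMap.mul' R P.Bismash (P.antipodeB.lTensor P.Bismash (P.comulH x)) =
      algebraMap R P.Bismash (counit x) := by
    rw [comulH, cv_apply _ _ x (ℛ R x)]
    rw [map_sum, map_sum]
    exact P.inH_antipodeH x (ℛ R x)
  rw [comul_tm, ← (ℛ R a).eq, map_sum, Finset.sum_mul]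
  simp only [map_sum, h1, h2]
  have h3 : ∀ b c : A, P.inA b * algebraMap R P.Bismash (counit x) * P.inA c =
      counit (R := R) x • P.inA (b * c) := by
    intro b c
    rw [Algebra.algebraMap_eq_smul_one, mul_smul_comm, mul_one, smul_mul_assoc, map_mul]
  simp only [h3, ← Finset.smul_sum, ← map_sum, sum_mul_antipode_eq_algebraMap_counit, counit_tm,
    AlgHom.commutes]
  rw [Algebra.algebraMap_eq_smul_one, Algebra.algebraMap_eq_smul_one, smul_smul, mul_comm]

instance : HopfAlgebra R P.Bismash where
  antipode := P.antipodeB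
  mul_antipode_rTensor_comul := P.hom_ext P.mul_antipode_left
  mul_antipode_lTensor_comul := P.hom_ext P.mul_antipode_right

end Hopf
end LinkedPair

section Star

/-- A `*`-Hopf algebra: a complex Hopf algebra with a conjugate linear, involutive,
antimultiplicative (`StarRing`, `StarModule`) and comultiplicative map `*`. Here `star` on
`H ⊗ H` is `x ⊗ y ↦ x* ⊗ y*`. -/
class StarHopfAlgebra (H : Type v) [Ring H] [HopfAlgebra ℂ H] extends
    StarRing H, StarModule ℂ H where
  comul_star : ∀ x : H, comul (R := ℂ) (star x) =
    Star.star (comul (R := ℂ) x : H ⊗[ℂ] H)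

variable {H : Type v} [Ring H] [HopfAlgebra ℂ H] [StarHopfAlgebra H]
open HopfAlgebra

/-- The representation `∑ x₁* ⊗ x₂*` of `Δ(x*)`. -/
def starRepr (x : H) : Coalgebra.Repr ℂ (star x) (H × H) where
  index := (ℛ ℂ x).index
  left i := star ((ℛ ℂ x).left i)
  right i := star ((ℛ ℂ x).right i)
  eq := by
    rw [StarHopfAlgebra.comul_star, ← (ℛ ℂ x).eq, star_sum]
    simp

theorem counit_star (x : H) : counit (R := ℂ) (star x) = star (counit (R := ℂ) x) := by
  have h1 := congrArg (fun t => counit (R := ℂ) (star (TensorProduct.lid ℂ H t)))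
    (Coalgebra.sum_counit_tmul_eq (starRepr x))
  have h2 := congrArg (fun t => counit (R := ℂ) (star (TensorProduct.rid ℂ H t)))
    (Coalgebra.sum_tmul_counit_eq (ℛ ℂ x))
  simp only [starRepr, map_sum, TensorProduct.lid_tmul, TensorProduct.rid_tmul, star_sum,
    star_smul, star_star, map_smul, smul_eq_mul, one_smul] at h1 h2
  rw [← h2, ← star_star (counit (R := ℂ) x), ← h1, star_star, star_sum]
  exact Finset.sum_congr rfl fun i _ => by simp [mul_comm]

theorem antipode_star_antipode (x : H) :
    antipode ℂ (star (antipode ℂ (star x))) = x := by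
  let T : H →ₗ[ℂ] H :=
    { toFun := fun x => star (antipode ℂ (star x))
      map_add' := by simp
      map_smul' := by simp }
  have h1 : cv (antipode ℂ) (antipode ℂ ∘ₗ T) = Algebra.linearMap ℂ H ∘ₗ counit := by
    ext x
    have h := congrArg star (sum_mul_antipode_eq_algebraMap_counit (starRepr x))
    simp only [starRepr, star_sum, star_mul, star_star, counit_star] at h
    rw [cv_apply _ _ x (ℛ ℂ x)]
    simp only [LinearMap.comp_apply, ← antipode_mul_antidistrib, ← map_sum]
    change antipode ℂ (∑ i ∈ (ℛ ℂ x).index,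
      star (antipode ℂ (star ((ℛ ℂ x).right i))) * (ℛ ℂ x).left i) = _
    rw [h]
    simp [Algebra.algebraMap_eq_smul_one]
  have h2 : cv LinearMap.id (antipode ℂ) = Algebra.linearMap ℂ H ∘ₗ counit := by
    ext x
    rw [cv_apply _ _ x (ℛ ℂ x)]
    exact sum_mul_antipode_eq_algebraMap_counit (ℛ ℂ x)
  have h3 : antipode ℂ ∘ₗ T = LinearMap.id := by
    rw [← one_cv (antipode ℂ ∘ₗ T), ← h2, cv_assoc, h1, cv_one]
  exact LinearMap.congr_fun h3 x

theorem antipode_bijective : Function.Bijective (antipode ℂ (A := H)) := by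
  refine ⟨Function.LeftInverse.injective (g := fun x => star (antipode ℂ (star x))) fun x => ?_,
    fun x => ⟨_, antipode_star_antipode x⟩⟩
  have h := antipode_star_antipode (star x)
  rw [star_star] at h
  change star (antipode ℂ (star (antipode ℂ x))) = x
  rw [h, star_star]

variable (H) in
/-- The antipode of a `*`-Hopf algebra, as a linear equivalence; its inverse is `S⁻¹`. -/
def antipodeEquiv : H ≃ₗ[ℂ] H := LinearEquiv.ofBijective (antipode ℂ) antipode_bijective

/-- A right `H`-comodule structure on `V`. -/
structure RightComodule (H : Type v) [Ring H] [HopfAlgebra ℂ H]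
    (V : Type w) [AddCommGroup V] [Module ℂ V] where
  /-- the coaction `v ↦ ∑ v₀ ⊗ v₁` -/
  coact : V →ₗ[ℂ] V ⊗[ℂ] H
  coassoc : ∀ v : V, TensorProduct.assoc ℂ V H H (coact.rTensor H (coact v)) =
    (comul (R := ℂ) (A := H)).lTensor V (coact v)
  counit_coact : ∀ v : V,
    TensorProduct.rid ℂ V ((counit (R := ℂ) (A := H)).lTensor V (coact v)) = v

/-- A sesquilinear form on `V`, linear in the first variable, is an inner product. -/
def IsInnerProduct {V : Type w} [AddCommGroup V] [Module ℂ V] (B : V →ₗ[ℂ] V →ₗ⋆[ℂ] ℂ) : Prop :=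
  (∀ u v : V, B v u = conj (B u v)) ∧ ∀ v : V, v ≠ 0 → 0 < (B v v).re

/-- Invariance of a sesquilinear form: `∑ ⟨u₀, v⟩ S(u₁) = ∑ ⟨u, v₀⟩ v₁*`. -/
def RightComodule.IsInvariant {V : Type w} [AddCommGroup V] [Module ℂ V]
    (ρ : RightComodule H V) (B : V →ₗ[ℂ] V →ₗ⋆[ℂ] ℂ) : Prop :=
  ∀ u v : V,
    TensorProduct.lid ℂ H (TensorProduct.map (B.flip v) (antipode ℂ) (ρ.coact u)) =
    TensorProduct.lid ℂ H
      (TensorProduct.map (B u) (starLinearEquiv ℂ (A := H)).toLinearMap (ρ.coact v))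

variable (H) in
/-- A compact quantum group: a `*`-Hopf algebra `H` such that every right `H`-comodule admits an
invariant inner product. -/
def IsCQG : Prop :=
  ∀ (V : Type w) [AddCommGroup V] [Module ℂ V] (ρ : RightComodule H V),
    ∃ B : V →ₗ[ℂ] V →ₗ⋆[ℂ] ℂ, IsInnerProduct B ∧ ρ.IsInvariant B

/-- `s` is given on elementary tensors by `(a # x)* = ∑ (x₁* ▶ a*) # x₂*`. -/
def LinkedPair.IsBismashStar {A : Type u} {H : Type v} [Ring A] [Ring H] [HopfAlgebra ℂ A]
    [HopfAlgebra ℂ H] [StarHopfAlgebra A] [StarHopfAlgebra H] (P : LinkedPair ℂ A H)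
    (s : P.Bismash → P.Bismash) : Prop :=
  ∀ (a : A) (x : H), s (P.tm a x) = ∑ i ∈ (ℛ ℂ x).index,
    P.tm (P.act (star ((ℛ ℂ x).left i)) (star a)) (star ((ℛ ℂ x).right i))

end Star

end QuantumLinkedPair
end

open QuantumLinkedPair

/-! The proposed involution is (a # x)* = (1 # x*)(a* # 1), so it is determined by the requirements
that it restrict to the given involutions on `A` and `H` and reverse products.

Antimultiplicativity can fail only on (1 # x)(b # 1) = ∑ (x₁ ▶ b) # x₂. With y = x*, moving the
`H`-factors of its star back to the right gives ∑ (y₂ ▶ (y₁* ▶ b)*) # y₃, which must equal b* # y.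
Applying ε to the `H`-leg turns this into ∑ y₂ ▶ (y₁* ▶ b)* = ε(y) b*, and convolving with S⁻¹ turns
that into the first condition (`star_act_iff`). Likewise comultiplicativity is automatic on `A`. On
1 # x the same reordering gives ρ(y) = ∑ y₂ ▶ ρ(y₁*)*, with the action on the `A`-leg, and this is
the second condition (`comul_star_iff`). Both comparisons use that the coefficient map is recovered
by a projection (`comp_cv_of_retract`).

For compactness, invariance of a form is rewritten without antipodes as ∑ ⟨u₀, v₀⟩ v₁* u₁ = ⟨u, v⟩ 1
(`isInvariant_iff`). A finite CQG `H` has a normalized two-sided integral h which is Hermitian and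
positive definite (`IsCQG.exists_haar`). Given an `A # H`-comodule, its `A`-part has an invariant
inner product; average it with h over the `H`-part. The average is positive definite, and it is
`H`-invariant because h is an integral. It stays `A`-invariant because of the exchange rule between
the two coactions (`coactH_coactA`) and the identity (h ⊗ id)(ρ(y)* ρ(x)) = h(y* x) 1
(`lid_rTensor_star_coact_mul`). Invariance under both parts gives invariance under `A # H`, since
the full coaction is the composite of the two (`coact_eq`). -/

noncomputable section
namespace QuantumLinkedPair

/-! ### Convolution along bilinear maps. -/

section Bcv

variable {R C M N K : Type*} [CommSemiring R] [AddCommMonoid C] [Module R C] [Coalgebra R C]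
  [AddCommMonoid M] [Module R M] [AddCommMonoid N] [Module R N] [AddCommMonoid K] [Module R K]

/-- The convolution `x ↦ ∑ β (f x₁) (g x₂)` of linear maps along a bilinear map `β`. -/
def bcv (β : M →ₗ[R] N →ₗ[R] K) (f : C →ₗ[R] M) (g : C →ₗ[R] N) : C →ₗ[R] K :=
  TensorProduct.lift (β.compl₁₂ f g) ∘ₗ comul

theorem bcv_apply {ι : Type*} (β : M →ₗ[R] N →ₗ[R] K) (f : C →ₗ[R] M) (g : C →ₗ[R] N) (x : C)
    (r : Coalgebra.Repr R x ι) :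
    bcv β f g x = ∑ i ∈ r.index, β (f (r.left i)) (g (r.right i)) := by
  simp [bcv, ← r.eq]

/-- Coassociativity together with the mixed associativity `h`. Four different pairings are allowed
so that actions and multiplications can be combined. -/
theorem bcv_assoc {M' N' P : Type*} [AddCommMonoid M'] [Module R M'] [AddCommMonoid N']
    [Module R N'] [AddCommMonoid P] [Module R P]
    (β : M' →ₗ[R] P →ₗ[R] K) (β₁ : M →ₗ[R] N →ₗ[R] M')
    (β₂ : M →ₗ[R] N' →ₗ[R] K) (β₃ : N →ₗ[R] P →ₗ[R] N')
    (h : ∀ a b c, β (β₁ a b) c = β₂ a (β₃ b c))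
    (f : C →ₗ[R] M) (g : C →ₗ[R] N) (k : C →ₗ[R] P) :
    bcv β (bcv β₁ f g) k = bcv β₂ f (bcv β₃ g k) := by
  ext x
  -- The map a ⊗ (b ⊗ c) ↦ β₂ (f a) (β₃ (g b) (k c)), applied to both sides of coassociativity.
  have key := congrArg (TensorProduct.lift
    ((LinearMap.llcomp R (C ⊗[R] C) N' K).flip
      (TensorProduct.lift (β₃.compl₁₂ g k)) ∘ₗ (β₂ ∘ₗ f)))
    (Coalgebra.sum_tmul_tmul_eq (ℛ R x) (fun i => ℛ R ((ℛ R x).left i))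
      (fun i => ℛ R ((ℛ R x).right i)))
  simp only [bcv_apply _ _ _ x (ℛ R x), bcv_apply _ _ _ _ (ℛ R _), map_sum, LinearMap.sum_apply, h]
  simpa using key

theorem bcv_counit (β : M →ₗ[R] N →ₗ[R] K) (f : C →ₗ[R] M) (n : N) :
    bcv β f (LinearMap.toSpanSingleton R N n ∘ₗ counit) = β.flip n ∘ₗ f := by
  ext x
  have key := congrArg (TensorProduct.lift (LinearMap.lsmul R K).flip ∘ₗ
    TensorProduct.map (β.flip n ∘ₗ f) LinearMap.id) (Coalgebra.sum_tmul_counit_eq (ℛ R x))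
  rw [bcv_apply _ _ _ x (ℛ R x)]
  simp only [map_sum, LinearMap.comp_apply, TensorProduct.map_tmul, TensorProduct.lift.tmul] at key
  simpa using key

theorem counit_bcv (β : M →ₗ[R] N →ₗ[R] K) (m : M) (g : C →ₗ[R] N) :
    bcv β (LinearMap.toSpanSingleton R M m ∘ₗ counit) g = β m ∘ₗ g := by
  ext x
  have key := congrArg (TensorProduct.lift (LinearMap.lsmul R K) ∘ₗ
    TensorProduct.map LinearMap.id (β m ∘ₗ g)) (Coalgebra.sum_counit_tmul_eq (ℛ R x))
  rw [bcv_apply _ _ _ x (ℛ R x)]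
  simp only [map_sum, LinearMap.comp_apply, TensorProduct.map_tmul, TensorProduct.lift.tmul] at key
  simpa using key

/-- If `(g x₁) (k x₂) = ε(x) n₀` in an algebra acting on `M` from the right and `n₀` acts trivially,
then acting by `g` and then by `k` is the identity. -/
theorem bcv_bcv_cancel (β : M →ₗ[R] N →ₗ[R] M) (γ : N →ₗ[R] N →ₗ[R] N) (n₀ : N)
    (h : ∀ a b c, β (β a b) c = β a (γ b c)) (h₀ : ∀ a, β a n₀ = a)
    (g k : C →ₗ[R] N) (hgk : bcv γ g k = LinearMap.toSpanSingleton R N n₀ ∘ₗ counit)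
    (f : C →ₗ[R] M) : bcv β (bcv β f g) k = f := by
  rw [bcv_assoc β β β γ h, hgk, bcv_counit]
  ext x
  exact h₀ _

end Bcv

/-! ### The inverse antipode. -/

section AntipodeInv
open HopfAlgebra

variable (H : Type v) [Ring H] [HopfAlgebra ℂ H] [StarHopfAlgebra H]

/-- The inverse of the antipode as a linear map. -/
def antipodeInv : H →ₗ[ℂ] H := (antipodeEquiv H).symm.toLinearMap

variable {H}

theorem antipodeInv_apply (x : H) : antipodeInv H x = (antipodeEquiv H).symm x := rfl

@[simp] theorem antipode_antipodeInv (x : H) : antipode ℂ (antipodeInv H x) = x :=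
  (antipodeEquiv H).apply_symm_apply x

/-- `∑ S⁻¹(x₂) x₁ = ε(x) 1` -/
theorem bcv_id_antipodeInv : bcv (LinearMap.mul ℂ H).flip LinearMap.id (antipodeInv H) =
    LinearMap.toSpanSingleton ℂ H 1 ∘ₗ counit := by
  ext x
  apply antipode_bijective.1
  have h := sum_antipode_mul_eq_smul (ℛ ℂ x)
  rw [bcv_apply _ _ _ x (ℛ ℂ x)]
  simpa [antipode_mul_antidistrib, antipode_antipodeInv] using h

/-- `∑ x₂ S⁻¹(x₁) = ε(x) 1` -/
theorem bcv_antipodeInv_id : bcv (LinearMap.mul ℂ H).flip (antipodeInv H) LinearMap.id =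
    LinearMap.toSpanSingleton ℂ H 1 ∘ₗ counit := by
  ext x
  apply antipode_bijective.1
  have h := sum_mul_antipode_eq_smul (ℛ ℂ x)
  rw [bcv_apply _ _ _ x (ℛ ℂ x)]
  simpa [antipode_mul_antidistrib, antipode_antipodeInv] using h

end AntipodeInv


/-! ### Reordering products by a commutation rule. -/

section Commutation

variable {R C B M : Type*} [CommSemiring R] [AddCommMonoid C] [Module R C] [Coalgebra R C]
  [Semiring B] [Algebra R B] [AddCommMonoid M] [Module R M]

theorem cv_eq_bcv (f g : C →ₗ[R] B) : cv f g = bcv (LinearMap.mul R B) f g := by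
  ext x
  simp [cv_apply _ _ x (ℛ R x), bcv_apply _ _ _ x (ℛ R x)]

/-- If `q(y) α(t) = ∑ α(τ(t, y₁)) q(y₂)`, then
`∑ q(y₂) α(f(y₁)) = ∑ α(τ(f(y₁), y₂)) q(y₃)`. -/
theorem bcv_flip_mul_of_comm (α : M →ₗ[R] B) (q : C →ₗ[R] B) (τ : M →ₗ[R] C →ₗ[R] M)
    (h : ∀ t, LinearMap.mulRight R (α t) ∘ₗ q = cv (α ∘ₗ τ t) q) (f : C →ₗ[R] M) :
    bcv (LinearMap.mul R B).flip (α ∘ₗ f) q = cv (α ∘ₗ bcv τ f LinearMap.id) q := by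
  -- The last two Sweedler legs are taken as one tensor in C ⊗ C, so that the commutation rule
  -- applies to Δ(x₂) as a whole.
  let β₂ : M →ₗ[R] C ⊗[R] C →ₗ[R] B :=
    (TensorProduct.lift.equiv (RingHom.id R) C C B).toLinearMap ∘ₗ
      ((LinearMap.llcomp R C B (C →ₗ[R] B) ((LinearMap.mul R B).compl₂ q)) ∘ₗ
        ((LinearMap.llcomp R C M B) α)) ∘ₗ τ
  have hβ : ∀ m y z, β₂ m (y ⊗ₜ z) = α (τ m y) * q z := fun m y z => rfl
  have h1 : α ∘ₗ bcv τ f LinearMap.id = bcv (τ.compr₂ α) f LinearMap.id := by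
    ext x
    simp [bcv_apply _ _ _ x (ℛ R x)]
  have h2 : bcv (TensorProduct.mk R C C) LinearMap.id LinearMap.id = (comul : C →ₗ[R] _) := by
    ext x
    rw [bcv_apply _ _ _ x (ℛ R x), ← (ℛ R x).eq]
    rfl
  have h3 : cv (bcv (τ.compr₂ α) f LinearMap.id) q =
      bcv ((LinearMap.mul R B).compl₂ q) (bcv (τ.compr₂ α) f LinearMap.id) LinearMap.id := by
    rw [cv_eq_bcv]
    rfl
  rw [h1, h3, bcv_assoc _ _ β₂ (TensorProduct.mk R C C) (fun a b c => rfl), h2]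
  ext x
  rw [bcv_apply _ _ _ x (ℛ R x), bcv_apply _ _ _ x (ℛ R x)]
  refine Finset.sum_congr rfl fun i _ => ?_
  have h4 := LinearMap.congr_fun (h (f ((ℛ R x).left i))) ((ℛ R x).right i)
  rw [cv_apply _ _ _ (ℛ R _)] at h4
  simp only [LinearMap.comp_apply, LinearMap.mulRight_apply] at h4
  rw [LinearMap.flip_apply, LinearMap.comp_apply, LinearMap.mul_apply', h4, ← (ℛ R _).eq, map_sum]
  simp only [hβ]

/-- By `h` the second leg contributes only its counit. Hence f can be read off from the convolution
of α ∘ f with q; this is what makes the two conditions of the theorem necessary. -/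
theorem comp_cv_of_retract (α : M →ₗ[R] B) (q : C →ₗ[R] B) (E : B →ₗ[R] M)
    (h : ∀ m y, E (α m * q y) = counit (R := R) y • m) (f : C →ₗ[R] M) :
    E ∘ₗ cv (α ∘ₗ f) q = f := by
  ext x
  have key := congrArg (TensorProduct.lift (LinearMap.lsmul R M).flip ∘ₗ
    TensorProduct.map f LinearMap.id) (Coalgebra.sum_tmul_counit_eq (ℛ R x))
  simp only [map_sum, LinearMap.comp_apply, TensorProduct.map_tmul, TensorProduct.lift.tmul] at key
  simp only [LinearMap.comp_apply, cv_apply _ _ x (ℛ R x), map_sum, h]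
  simpa using key

end Commutation

section StarConj

variable {M N : Type*} [AddCommMonoid M] [StarAddMonoid M] [Module ℂ M] [StarModule ℂ M]
  [AddCommMonoid N] [StarAddMonoid N] [Module ℂ N] [StarModule ℂ N]

/-- The linear map `x ↦ f(x*)*`. -/
def starConj (f : M →ₗ[ℂ] N) : M →ₗ[ℂ] N where
  toFun x := star (f (star x))
  map_add' := by simp
  map_smul' := by simp

theorem starConj_apply (f : M →ₗ[ℂ] N) (x : M) : starConj f x = star (f (star x)) := rfl

end StarConj

namespace LinkedPair

/-! ### The projections of `A # H` and the action on the `A`-leg of H ⊗ A. -/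

section Proj
variable {R : Type*} {A : Type u} {H : Type v} [CommRing R] [Ring A] [Ring H]
  [Bialgebra R A] [Bialgebra R H] (P : LinkedPair R A H)

/-- The projection `a # x ↦ ε(x) a`. -/
def piA : P.Bismash →ₗ[R] A :=
  P.liftB ((LinearMap.lsmul R A).flip.compl₂ counit)

/-- The projection `a # x ↦ ε(a) x`. -/
def piH : P.Bismash →ₗ[R] H :=
  P.liftB ((LinearMap.lsmul R H).comp counit)

theorem piA_tm (a : A) (x : H) : P.piA (P.tm a x) = counit (R := R) x • a := rfl
theorem piH_tm (a : A) (x : H) : P.piH (P.tm a x) = counit (R := R) a • x := rfl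

/-- `t ⊗ y ↦ ∑ t_H ⊗ (y ▶ t_A)` -/
def actT : H ⊗[R] A →ₗ[R] H →ₗ[R] H ⊗[R] A := (LinearMap.lTensorHom H ∘ₗ P.act).flip

theorem actT_apply (t : H ⊗[R] A) (y : H) : P.actT t y = (P.act y).lTensor H t := rfl

theorem actT_actT (t : H ⊗[R] A) (y z : H) : P.actT (P.actT t y) z = P.actT t (z * y) := by
  have h : P.act (z * y) = P.act z ∘ₗ P.act y := LinearMap.ext fun a => P.mul_act z y a
  rw [actT_apply, actT_apply, actT_apply, h, LinearMap.lTensor_comp]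
  rfl

theorem actT_one (t : H ⊗[R] A) : P.actT t 1 = t := by
  have h : P.act 1 = LinearMap.id := LinearMap.ext fun a => P.one_act a
  rw [actT_apply, h, LinearMap.lTensor_id]
  rfl

theorem piA_inA_mul_inH (a : A) (x : H) :
    P.piA (P.inA a * P.inH x) = counit (R := R) x • a := by
  rw [inA_mul_inH, piA_tm]

theorem map_piH_piA_jK_mul_jQ (t : H ⊗[R] A) (y : H) :
    TensorProduct.map P.piH P.piA (P.jK t * P.jQ y) = counit (R := R) y • t := by
  induction t with
  | zero => simp
  | add s t hs ht => simp only [map_add, add_mul, smul_add, hs, ht]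
  | tmul h a =>
    rw [jK_tmul, jQ_apply, Algebra.TensorProduct.tmul_mul_tmul, mul_one, TensorProduct.map_tmul,
      piA_inA_mul_inH, inH_apply, piH_tm, Bialgebra.counit_one, one_smul, TensorProduct.tmul_smul]

end Proj

/-! ### The involution of `A # H` and the two compatibility conditions. -/

section Star
open HopfAlgebra
variable {A : Type u} {H : Type v} [Ring A] [Ring H] [HopfAlgebra ℂ A] [HopfAlgebra ℂ H]
  [StarHopfAlgebra A] [StarHopfAlgebra H] (P : LinkedPair ℂ A H)

/-- `∑ y₂ ▶ (y₁* ▶ b)* = ε(y) b*` -/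
theorem star_act_iff (b : A) :
    (∀ x, star (P.act x b) = P.act ((antipodeEquiv H).symm (star x)) (star b)) ↔
    bcv P.act.flip (starConj (P.act.flip b)) LinearMap.id =
      LinearMap.toSpanSingleton ℂ A (star b) ∘ₗ counit := by
  -- Written on the right, ▶ is an action of the opposite algebra of `H`, whose antipode is S⁻¹;
  -- hence the flipped multiplication. Convolving with S⁻¹ and with the identity then undo each
  -- other.
  have hm : ∀ (a : A) (y z : H), P.act.flip (P.act.flip a y) z =
      P.act.flip a ((LinearMap.mul ℂ H).flip y z) := fun a y z => (P.mul_act z y a).symm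
  have h1 : (∀ x, star (P.act x b) = P.act ((antipodeEquiv H).symm (star x)) (star b)) ↔
      starConj (P.act.flip b) = P.act.flip (star b) ∘ₗ antipodeInv H := by
    constructor
    · intro h
      ext y
      simpa [starConj_apply, antipodeInv_apply] using h (star y)
    · intro h x
      simpa [starConj_apply, antipodeInv_apply] using LinearMap.congr_fun h (star x)
  rw [h1]
  have h2 : P.act.flip (star b) ∘ₗ antipodeInv H = bcv P.act.flip
      (LinearMap.toSpanSingleton ℂ A (star b) ∘ₗ counit) (antipodeInv H) := by
    rw [counit_bcv]
  constructor
  · intro h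
    rw [h, h2]
    exact bcv_bcv_cancel P.act.flip (LinearMap.mul ℂ H).flip 1 hm P.one_act _ _
      bcv_antipodeInv_id _
  · intro h
    rw [h2, ← h]
    exact (bcv_bcv_cancel P.act.flip (LinearMap.mul ℂ H).flip 1 hm P.one_act _ _
      bcv_id_antipodeInv _).symm

/-- Substituting y = x* turns the second condition into an equality of linear maps, ρ(y) = ∑ y₂ ▶
ρ(y₁*)*, which convolution can handle. -/
theorem star_coact_iff :
    (∀ x : H, P.coact (star x) = ∑ i ∈ (ℛ ℂ x).index,
      (P.act (star ((ℛ ℂ x).right i))).lTensor H (star (P.coact ((ℛ ℂ x).left i)))) ↔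
    P.coact = bcv P.actT (starConj P.coact) LinearMap.id := by
  have h : ∀ x : H, bcv P.actT (starConj P.coact) LinearMap.id (star x) =
      ∑ i ∈ (ℛ ℂ x).index,
      (P.act (star ((ℛ ℂ x).right i))).lTensor H (star (P.coact ((ℛ ℂ x).left i))) := by
    intro x
    rw [bcv_apply _ _ _ _ (starRepr x)]
    simp [starRepr, starConj_apply, actT_apply]
  simp only [← h]
  constructor
  · intro k
    ext y
    simpa using k (star y)
  · intro k x
    exact LinearMap.congr_fun k (star x)

/-- The left side is what antimultiplicativity predicts for the star of (1 # x)(b # 1) = ∑ (x₁ ▶ b)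
# x₂. The commutation rule of `A # H` brings it to normal form, with the `A`-factor on the left. -/
theorem inH_star_mul_inA (b : A) (x : H) :
    ∑ i ∈ (ℛ ℂ x).index, P.inH (star ((ℛ ℂ x).right i)) *
      P.inA (star (P.act ((ℛ ℂ x).left i) b)) =
    cv (P.inA.toLinearMap ∘ₗ bcv P.act.flip (starConj (P.act.flip b)) LinearMap.id)
      P.inH.toLinearMap (star x) := by
  rw [← bcv_flip_mul_of_comm P.inA.toLinearMap P.inH.toLinearMap P.act.flip P.inH_mul_inA]
  rw [bcv_apply _ _ _ _ (starRepr x)]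
  simp [starRepr, starConj_apply]

theorem inA_star_mul_inH (b : A) (y : H) :
    cv (P.inA.toLinearMap ∘ₗ LinearMap.toSpanSingleton ℂ A (star b) ∘ₗ counit)
      P.inH.toLinearMap y = P.inA (star b) * P.inH y := by
  rw [cv_eq_bcv, ← LinearMap.comp_assoc]
  have h : P.inA.toLinearMap ∘ₗ LinearMap.toSpanSingleton ℂ A (star b) =
      LinearMap.toSpanSingleton ℂ P.Bismash (P.inA (star b)) := by
    ext; simp
  rw [h, counit_bcv]
  rfl

/-- The map `a # x ↦ (1 # x*) (a* # 1)`. -/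
def starB (m : P.Bismash) : P.Bismash :=
  P.liftB ((LinearMap.mul ℂ P.Bismash).flip.compl₁₂ P.inA.toLinearMap P.inH.toLinearMap)
    (P.toB (star (show A ⊗[ℂ] H from m)))

theorem starB_tm (a : A) (x : H) :
    P.starB (P.tm a x) = P.inH (star x) * P.inA (star a) := by
  change P.liftB _ (P.toB (star (a ⊗ₜ[ℂ] x))) = _
  rw [TensorProduct.star_tmul]
  rfl

theorem starB_add (m n : P.Bismash) : P.starB (m + n) = P.starB m + P.starB n := by
  change P.liftB _ (P.toB (star ((show A ⊗[ℂ] H from m) + (show A ⊗[ℂ] H from n)))) = _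
  rw [star_add, map_add, map_add]
  rfl

theorem starB_smul (c : ℂ) (m : P.Bismash) : P.starB (c • m) = star c • P.starB m := by
  change P.liftB _ (P.toB (star (c • (show A ⊗[ℂ] H from m)))) = _
  rw [star_smul, map_smul, map_smul]
  rfl

/-- `starB` as an additive map -/
def starBHom : P.Bismash →+ P.Bismash := AddMonoidHom.mk' P.starB P.starB_add

theorem starBHom_apply (m : P.Bismash) : P.starBHom m = P.starB m := rfl

theorem starB_inA_mul (a : A) (m : P.Bismash) :
    P.starBHom (P.inA a * m) = P.starBHom m * P.inA (star a) := by
  induction m using P.induction_on with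
  | h b y =>
    rw [inA_mul, leftA_tm, starBHom_apply, starBHom_apply, starB_tm, starB_tm, star_mul, map_mul,
      mul_assoc]
  | h0 => simp
  | ha m n hm hn => simp only [mul_add, map_add, hm, hn, add_mul]

theorem starB_mul_inH (x : H) (m : P.Bismash) :
    P.starBHom (m * P.inH x) = P.inH (star x) * P.starBHom m := by
  induction m using P.induction_on with
  | h b y =>
    rw [← inA_mul_inH, mul_assoc, ← map_mul, inA_mul_inH, inA_mul_inH, starBHom_apply,
      starBHom_apply, starB_tm, starB_tm, star_mul, map_mul, mul_assoc]
  | h0 => simp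
  | ha m n hm hn => simp only [mul_add, map_add, hm, hn, add_mul]

/-- The Sweedler sum is the product (1 # x*)(a* # 1) multiplied out; the product form is the one
used from here on. -/
theorem isBismashStar_iff (s : P.Bismash → P.Bismash) :
    P.IsBismashStar s ↔ ∀ a x, s (P.tm a x) = P.inH (star x) * P.inA (star a) := by
  have h : ∀ (a : A) (x : H), P.inH (star x) * P.inA (star a) = ∑ i ∈ (ℛ ℂ x).index,
      P.tm (P.act (star ((ℛ ℂ x).left i)) (star a)) (star ((ℛ ℂ x).right i)) := by
    intro a x
    rw [inH_apply, inA_apply, P.tm_mul_tm _ _ (starRepr x)]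
    simp [starRepr]
  simp only [IsBismashStar, h]

/-- The only nontrivial case of antimultiplicativity: in the normal form of `inH_star_mul_inA` the
coefficient collapses to ε(y) b* by `star_act_iff`. Applied to the star of a # x, it also yields
involutivity. -/
theorem starB_inH_mul_inA
    (h : ∀ (x : H) (a : A), star (P.act x a) = P.act ((antipodeEquiv H).symm (star x)) (star a))
    (x : H) (b : A) :
    P.starBHom (P.inH x * P.inA b) = P.inA (star b) * P.inH (star x) := by
  have h1 := P.inH_star_mul_inA b x
  rw [(P.star_act_iff b).1 fun x => h x b, inA_star_mul_inH] at h1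
  rw [inH_mul_inA_apply, map_sum, ← h1]
  exact Finset.sum_congr rfl fun i _ => by rw [inA_mul_inH, starBHom_apply, starB_tm]

/-- The `*`-ring structure on `A # H`. -/
@[reducible] def starRingB
    (h : ∀ (x : H) (a : A), star (P.act x a) = P.act ((antipodeEquiv H).symm (star x)) (star a)) :
    StarRing P.Bismash where
  star := P.starB
  star_involutive m := by
    change P.starBHom (P.starBHom m) = m
    induction m using P.induction_on with
    | h a x =>
      rw [P.starBHom_apply (P.tm a x), starB_tm, P.starB_inH_mul_inA h, star_star, star_star,
        inA_mul_inH]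
    | h0 => simp
    | ha m n hm hn => rw [map_add, map_add, hm, hn]
  star_mul m n := by
    change P.starBHom (m * n) = P.starBHom n * P.starBHom m
    induction m using P.induction_on with
    | h0 => simp
    | ha m m' hm hn => simp only [map_add, add_mul, mul_add, hm, hn]
    | h a x =>
      induction n using P.induction_on with
      | h0 => simp
      | ha m m' hm hn => simp only [map_add, add_mul, mul_add, hm, hn]
      | h b y =>
        have e : P.tm a x * P.tm b y = P.inA a * (P.inH x * P.inA b * P.inH y) := by
          simp only [← inA_mul_inH, mul_assoc]
        rw [e, starB_inA_mul, starB_mul_inH, P.starB_inH_mul_inA h, starBHom_apply, starBHom_apply,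
          starB_tm, starB_tm]
        simp only [mul_assoc]
  star_add := P.starB_add

section Comul
variable [StarRing P.Bismash] [StarModule ℂ P.Bismash]

theorem star_jA (hA : ∀ a, star (P.inA a) = P.inA (star a)) (s : A ⊗[ℂ] A) :
    star (P.jA s) = P.jA (star s) := by
  induction s with
  | zero => simp
  | add s t hs ht => simp only [map_add, star_add, hs, ht]
  | tmul a b => simp [jA_tmul, hA]

theorem star_jK (hA : ∀ a, star (P.inA a) = P.inA (star a))
    (hH : ∀ x, star (P.inH x) = P.inH (star x)) (s : H ⊗[ℂ] A) :
    star (P.jK s) = P.jK (star s) := by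
  induction s with
  | zero => simp
  | add s t hs ht => simp only [map_add, star_add, hs, ht]
  | tmul a b => simp [jK_tmul, hA, hH]

theorem star_jQ (hH : ∀ x, star (P.inH x) = P.inH (star x)) (x : H) :
    star (P.jQ x) = P.jQ (star x) := by
  simp [jQ_apply, hH]

/-- Starring Δ(1 # x) = ∑ `jK` (ρ x₁) `jQ` x₂ puts the `jQ`-factor first; `jQ_mul_jK` moves it back
at the cost of an action on the `A`-leg of ρ(x₁)*. -/
theorem star_comulH (hA : ∀ a, star (P.inA a) = P.inA (star a))
    (hH : ∀ x, star (P.inH x) = P.inH (star x)) (x : H) :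
    star (P.comulH x) = cv (P.jK.toLinearMap ∘ₗ bcv P.actT (starConj P.coact) LinearMap.id)
      P.jQ.toLinearMap (star x) := by
  rw [← bcv_flip_mul_of_comm P.jK.toLinearMap P.jQ.toLinearMap P.actT P.jQ_mul_jK, comulH,
    cv_apply _ _ _ (ℛ ℂ x), bcv_apply _ _ _ _ (starRepr x)]
  simp [starRepr, starConj_apply, star_jK P hA hH, star_jQ P hH]

/-- Both Δ ∘ * and (* ⊗ *) ∘ Δ are additive and reverse products, and on `A` they agree since `A` is
a `*`-Hopf algebra. Only the elements 1 # x remain, where `star_comulH` applies. -/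
theorem comul_star_iff (hA : ∀ a, star (P.inA a) = P.inA (star a))
    (hH : ∀ x, star (P.inH x) = P.inH (star x)) :
    (∀ m : P.Bismash, comul (R := ℂ) (star m) =
      Star.star (comul (R := ℂ) m : P.Bismash ⊗[ℂ] P.Bismash)) ↔
    P.coact = bcv P.actT (starConj P.coact) LinearMap.id := by
  have key : (∀ x, P.comulH (star x) = star (P.comulH x)) ↔
      P.coact = bcv P.actT (starConj P.coact) LinearMap.id := by
    constructor
    · intro k
      have e : P.comulH = cv (P.jK.toLinearMap ∘ₗ bcv P.actT (starConj P.coact) LinearMap.id)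
          P.jQ.toLinearMap := by
        ext y
        rw [← star_star y, ← P.star_comulH hA hH, ← k]
      -- `piH` ⊗ `piA` recovers ρ from x ↦ Δ(1 # x), so the coefficients of two equal normal forms
      -- coincide.
      have r := comp_cv_of_retract P.jK.toLinearMap P.jQ.toLinearMap
        (TensorProduct.map P.piH P.piA) P.map_piH_piA_jK_mul_jQ
      conv_lhs => rw [← r P.coact, ← comulH, e, r]
    · intro k x
      rw [P.star_comulH hA hH, ← k, ← comulH]
  rw [← key]
  constructor
  · intro k x
    have := k (P.inH x)
    rw [hH] at this
    rw [← comulHom_inH, ← comulHom_inH]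
    exact this
  · intro k m
    change P.comulHom (star m) = star (P.comulHom m)
    induction m using P.induction_on with
    | h0 => simp
    | ha m n hm hn => simp only [star_add, map_add, hm, hn]
    | h a x =>
      rw [← inA_mul_inH, star_mul, map_mul, map_mul, star_mul, hA, hH, comulHom_inH, comulHom_inA,
        comulHom_inA, comulHom_inH, k, P.star_jA hA, StarHopfAlgebra.comul_star]

end Comul

theorem starHopfAlgebra_iff :
    (∃ _ : StarHopfAlgebra P.Bismash, P.IsBismashStar star) ↔
      ((∀ (x : H) (a : A),
          star (P.act x a) = P.act ((antipodeEquiv H).symm (star x)) (star a)) ∧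
        (∀ x : H, P.coact (star x) = ∑ i ∈ (ℛ ℂ x).index,
          (P.act (star ((ℛ ℂ x).right i))).lTensor H (star (P.coact ((ℛ ℂ x).left i))))) := by
  rw [star_coact_iff]
  constructor
  · rintro ⟨_, hs⟩
    rw [isBismashStar_iff] at hs
    have hA : ∀ a, star (P.inA a) = P.inA (star a) := fun a => by
      rw [inA_apply, hs, star_one, map_one, one_mul]
    have hH : ∀ x, star (P.inH x) = P.inH (star x) := fun x => by
      rw [inH_apply, hs, star_one, map_one, mul_one]
    refine ⟨fun x a => ?_, (P.comul_star_iff hA hH).1 StarHopfAlgebra.comul_star⟩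
    revert x
    rw [star_act_iff]
    have r := comp_cv_of_retract P.inA.toLinearMap P.inH.toLinearMap P.piA
      P.piA_inA_mul_inH
    -- Both sides become `piA` of normal forms in `A # H`. These agree because each computes the
    -- star of (1 # y*)(b # 1).
    rw [← r (bcv _ _ _), ← r (_ ∘ₗ counit)]
    congr 1
    ext y
    rw [← star_star y, ← inH_star_mul_inA, inA_star_mul_inH, ← hA, ← hH, ← star_mul,
      inH_mul_inA_apply, star_sum]
    exact Finset.sum_congr rfl fun i _ => by rw [star_mul, hA, hH]
  · rintro ⟨h1, h2⟩
    let _ : StarRing P.Bismash := P.starRingB h1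
    let _ : StarModule ℂ P.Bismash := ⟨P.starB_smul⟩
    have hs : ∀ a x, star (P.tm a x) = P.inH (star x) * P.inA (star a) := P.starB_tm
    have hA : ∀ a, star (P.inA a) = P.inA (star a) := fun a => by
      rw [inA_apply, hs, star_one, map_one, one_mul]
    have hH : ∀ x, star (P.inH x) = P.inH (star x) := fun x => by
      rw [inH_apply, hs, star_one, map_one, mul_one]
    exact ⟨{ comul_star := (P.comul_star_iff hA hH).2 h2 }, (P.isBismashStar_iff _).2 hs⟩

end Star
end LinkedPair

/-! ### The algebra-valued extension of a sesquilinear form. -/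

section Form

variable {V : Type*} {D D' : Type*} [AddCommGroup V] [Module ℂ V]
  [Ring D] [Algebra ℂ D] [StarRing D] [StarModule ℂ D]
  [Ring D'] [Algebra ℂ D'] [StarRing D'] [StarModule ℂ D']
  (B : V →ₗ[ℂ] V →ₗ⋆[ℂ] ℂ)

/-- `u ↦ ∑ ⟨u, t₀⟩ t₁*` for `t = ∑ t₀ ⊗ t₁`. -/
def formStar (t : V ⊗[ℂ] D) : V →ₗ[ℂ] D where
  toFun u := TensorProduct.lid ℂ D
    (TensorProduct.map (B u) (starLinearEquiv ℂ (A := D)).toLinearMap t)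
  map_add' u u' := by simp [TensorProduct.map_add_left]
  map_smul' c u := by simp [TensorProduct.map_smul_left]

theorem formStar_apply (t : V ⊗[ℂ] D) (u : V) : formStar B t u = TensorProduct.lid ℂ D
    (TensorProduct.map (B u) (starLinearEquiv ℂ (A := D)).toLinearMap t) := rfl

theorem formStar_tmul (v : V) (b : D) (u : V) : formStar B (v ⊗ₜ b) u = B u v • star b := by
  simp [formStar_apply]

theorem formStar_add (s t : V ⊗[ℂ] D) : formStar B (s + t) = formStar B s + formStar B t := by
  ext u
  simp [formStar_apply]

theorem formStar_smul (c : ℂ) (t : V ⊗[ℂ] D) : formStar B (c • t) = conj c • formStar B t := by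
  ext u
  simp [formStar_apply]

/-- The `D`-valued sesquilinear form `(u ⊗ a, v ⊗ b) ↦ ⟨u, v⟩ b* a` on `V ⊗ D`. -/
def extForm : V ⊗[ℂ] D →ₗ[ℂ] V ⊗[ℂ] D →ₗ⋆[ℂ] D :=
  LinearMap.mk₂'ₛₗ (RingHom.id ℂ) (starRingEnd ℂ)
    (fun s t => LinearMap.mul' ℂ D ((formStar B t).rTensor D s))
    (fun _ _ _ => by simp only [map_add]) (fun _ _ _ => by simp only [map_smul, RingHom.id_apply])
    (fun _ _ _ => by
      simp only [formStar_add, LinearMap.rTensor_add, map_add, LinearMap.add_apply])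
    (fun _ _ _ => by
      simp only [formStar_smul, LinearMap.rTensor_smul, map_smul, LinearMap.smul_apply])

theorem extForm_apply (s t : V ⊗[ℂ] D) :
    extForm B s t = LinearMap.mul' ℂ D ((formStar B t).rTensor D s) := rfl

@[simp] theorem extForm_tmul (u v : V) (a b : D) :
    extForm B (u ⊗ₜ a) (v ⊗ₜ b) = B u v • (star b * a) := by
  simp [extForm_apply, formStar_tmul]

/-- The values involve only products and stars in `D`. The case needed is f = Δ. -/
theorem extForm_lTensor (f : D →ₐ[ℂ] D') (hf : ∀ d, f (star d) = star (f d)) (s t : V ⊗[ℂ] D) :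
    extForm B (f.toLinearMap.lTensor V s) (f.toLinearMap.lTensor V t) = f (extForm B s t) := by
  induction s with
  | zero => simp
  | add s s' h h' => simp only [map_add, LinearMap.add_apply, h, h']
  | tmul u a =>
    induction t with
    | zero => simp
    | add s s' h h' => simp only [map_add, h, h']
    | tmul v b => simp [hf]

theorem star_extForm (hB : ∀ u v, B v u = conj (B u v)) (s t : V ⊗[ℂ] D) :
    star (extForm B s t) = extForm B t s := by
  induction s with
  | zero => simp
  | add s s' h h' => simp only [map_add, star_add, LinearMap.add_apply, h, h']
  | tmul u a =>
    induction t with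
    | zero => simp
    | add s s' h h' => simp only [map_add, star_add, LinearMap.add_apply, h, h']
    | tmul v b => simp [hB u v]

end Form

/-! ### Comodules and invariant forms. -/

namespace RightComodule
open HopfAlgebra

variable {V : Type w} [AddCommGroup V] [Module ℂ V] {D : Type u} {D' : Type v} [Ring D] [Ring D']
  [HopfAlgebra ℂ D] [HopfAlgebra ℂ D']

/-- Multiplying the defining identity for u₀ on the right by u₁ cancels S(u₁) u₂; conversely,
multiplying by S(u₁) cancels u₁ S(u₂). The new form has no antipode, so it is compatible with
`*`-homomorphisms and with products. -/
theorem isInvariant_iff [StarHopfAlgebra D] (ρ : RightComodule D V) (B : V →ₗ[ℂ] V →ₗ⋆[ℂ] ℂ) :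
    ρ.IsInvariant B ↔
      ∀ u v, extForm B (ρ.coact u) (ρ.coact v) = B u v • (1 : D) := by
  constructor
  · intro h u v
    have h1 : formStar B (ρ.coact v) = (TensorProduct.lid ℂ D).toLinearMap ∘ₗ
        TensorProduct.map (B.flip v) (antipode ℂ) ∘ₗ ρ.coact := by
      ext u
      exact (h u v).symm
    -- w ⊗ (b ⊗ a) ↦ ⟨w, v⟩ S(b) a.
    let F : V ⊗[ℂ] (D ⊗[ℂ] D) →ₗ[ℂ] D := (TensorProduct.lid ℂ D).toLinearMap ∘ₗ
      TensorProduct.map (B.flip v) (LinearMap.mul' ℂ D ∘ₗ (antipode ℂ).rTensor D)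
    have h2 : ∀ s : V ⊗[ℂ] D, LinearMap.mul' ℂ D ((formStar B (ρ.coact v)).rTensor D s) =
        F (TensorProduct.assoc ℂ V D D (ρ.coact.rTensor D s)) := by
      intro s
      rw [h1]
      induction s with
      | zero => simp
      | add s s' h h' => simp only [map_add, h, h']
      | tmul w a =>
        simp only [LinearMap.rTensor_tmul, LinearMap.comp_apply]
        induction ρ.coact w with
        | zero => simp
        | add s s' h h' => simp only [map_add, TensorProduct.add_tmul, h, h']
        | tmul x b => simp [F]
    have h3 : ∀ s : V ⊗[ℂ] D, F ((comul (R := ℂ) (A := D)).lTensor V s) =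
        B (TensorProduct.rid ℂ V ((counit (R := ℂ) (A := D)).lTensor V s)) v • (1 : D) := by
      intro s
      induction s with
      | zero => simp
      | add s s' h h' => simp only [map_add, LinearMap.add_apply, add_smul, h, h']
      | tmul w a =>
        simp [F, mul_antipode_rTensor_comul_apply, Algebra.algebraMap_eq_smul_one, smul_smul,
          mul_comm]
    rw [extForm_apply, h2, ρ.coassoc, h3, ρ.counit_coact]
  · intro h u v
    -- w ⊗ (b ⊗ a) ↦ ∑ ⟨w, v₀⟩ v₁* b S(a).
    let G : V ⊗[ℂ] (D ⊗[ℂ] D) →ₗ[ℂ] D := LinearMap.mul' ℂ D ∘ₗ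
      TensorProduct.map (formStar B (ρ.coact v)) (LinearMap.mul' ℂ D ∘ₗ (antipode ℂ).lTensor D)
    have h1 : ∀ s : V ⊗[ℂ] D, TensorProduct.lid ℂ D
        (TensorProduct.map (B.flip v) (antipode ℂ) s) =
        G (TensorProduct.assoc ℂ V D D (ρ.coact.rTensor D s)) := by
      intro s
      induction s with
      | zero => simp
      | add s s' h h' => simp only [map_add, h, h']
      | tmul w a =>
        have h2 : ∀ t : V ⊗[ℂ] D, G (TensorProduct.assoc ℂ V D D (t ⊗ₜ a)) =
            extForm B t (ρ.coact v) * antipode ℂ a := by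
          intro t
          induction t with
          | zero => simp
          | add s s' h h' =>
            simp only [map_add, TensorProduct.add_tmul, h, h', LinearMap.add_apply, add_mul]
          | tmul x b => simp [G, extForm_apply, mul_assoc]
        rw [LinearMap.rTensor_tmul, h2, h]
        simp
    have h3 : ∀ s : V ⊗[ℂ] D, G ((comul (R := ℂ) (A := D)).lTensor V s) =
        formStar B (ρ.coact v)
          (TensorProduct.rid ℂ V ((counit (R := ℂ) (A := D)).lTensor V s)) := by
      intro s
      induction s with
      | zero => simp
      | add s s' h h' => simp only [map_add, h, h']
      | tmul w a =>
        simp [G, mul_antipode_lTensor_comul_apply, Algebra.algebraMap_eq_smul_one]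
    rw [h1, ρ.coassoc, h3, ρ.counit_coact]
    rfl

/-- For morphisms of coalgebras `f : D → D₁` and `g : D → D₂`, the corresponding coactions satisfy
`(ρ_f ⊗ id) ρ_g = (id ⊗ (f ⊗ g) Δ) ρ`. -/
theorem assoc_rTensor_lTensor (ρ : RightComodule D V) {D₁ D₂ : Type*} [AddCommGroup D₁]
    [Module ℂ D₁] [AddCommGroup D₂] [Module ℂ D₂] (f : D →ₗ[ℂ] D₁) (g : D →ₗ[ℂ] D₂) (v : V) :
    TensorProduct.assoc ℂ V D₁ D₂
      ((f.lTensor V ∘ₗ ρ.coact).rTensor D₂ (g.lTensor V (ρ.coact v))) =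
    (TensorProduct.map f g ∘ₗ comul).lTensor V (ρ.coact v) := by
  have h1 : ∀ s : V ⊗[ℂ] D, TensorProduct.assoc ℂ V D₁ D₂
      ((f.lTensor V ∘ₗ ρ.coact).rTensor D₂ (g.lTensor V s)) =
      (TensorProduct.map f g).lTensor V
        (TensorProduct.assoc ℂ V D D (ρ.coact.rTensor D s)) := by
    intro s
    induction s with
    | zero => simp
    | add s s' h h' => simp only [map_add, h, h']
    | tmul w a =>
      simp only [LinearMap.rTensor_tmul, LinearMap.lTensor_tmul, LinearMap.comp_apply]
      induction ρ.coact w with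
      | zero => simp
      | add s s' h h' => simp only [map_add, TensorProduct.add_tmul, h, h']
      | tmul x b => simp
  rw [h1, ρ.coassoc, ← LinearMap.lTensor_comp_apply]

/-- The comodule structure induced by a morphism of coalgebras. -/
def push (ρ : RightComodule D V) (f : D →ₗ[ℂ] D')
    (hf : ∀ d, comul (R := ℂ) (f d) = TensorProduct.map f f (comul d))
    (hε : ∀ d, counit (R := ℂ) (f d) = counit (R := ℂ) d) : RightComodule D' V where
  coact := f.lTensor V ∘ₗ ρ.coact
  coassoc v := by
    have h2 : TensorProduct.map f f ∘ₗ comul = comul ∘ₗ f := by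
      ext d
      exact (hf d).symm
    rw [LinearMap.comp_apply, ρ.assoc_rTensor_lTensor f f, h2, LinearMap.lTensor_comp_apply]
  counit_coact v := by
    have h : counit ∘ₗ f = counit (R := ℂ) := by
      ext d
      exact hε d
    rw [LinearMap.comp_apply, ← LinearMap.lTensor_comp_apply, h, ρ.counit_coact]

variable (D) in
/-- A Hopf algebra as a right comodule over itself. -/
def regular : RightComodule D D where
  coact := comul
  coassoc := Coalgebra.coassoc_apply
  counit_coact v := by simp

/-- Transport of a comodule structure along a linear equivalence. -/
def congr {W : Type*} [AddCommGroup W] [Module ℂ W] (ρ : RightComodule D V) (e : V ≃ₗ[ℂ] W) :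
    RightComodule D W where
  coact := e.toLinearMap.rTensor D ∘ₗ ρ.coact ∘ₗ e.symm.toLinearMap
  coassoc w := by
    have h1 : ∀ s : V ⊗[ℂ] D, TensorProduct.assoc ℂ W D D
        ((e.toLinearMap.rTensor D ∘ₗ ρ.coact ∘ₗ e.symm.toLinearMap).rTensor D
          (e.toLinearMap.rTensor D s)) =
        e.toLinearMap.rTensor (D ⊗[ℂ] D)
          (TensorProduct.assoc ℂ V D D (ρ.coact.rTensor D s)) := by
      intro s
      induction s with
      | zero => simp
      | add s s' h h' => simp only [map_add, h, h']
      | tmul w a =>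
        simp only [LinearMap.rTensor_tmul, LinearMap.comp_apply, LinearEquiv.coe_coe,
          LinearEquiv.symm_apply_apply]
        induction ρ.coact w with
        | zero => simp
        | add s s' h h' => simp only [map_add, TensorProduct.add_tmul, h, h']
        | tmul x b => simp
    simp only [LinearMap.comp_apply]
    rw [h1, ρ.coassoc]
    generalize ρ.coact _ = s
    induction s with
    | zero => simp
    | add s s' h h' => simp only [map_add, h, h']
    | tmul x b => simp
  counit_coact w := by
    have h : ∀ s : V ⊗[ℂ] D, TensorProduct.rid ℂ W
        ((counit (R := ℂ) (A := D)).lTensor W (e.toLinearMap.rTensor D s)) =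
        e (TensorProduct.rid ℂ V ((counit (R := ℂ) (A := D)).lTensor V s)) := by
      intro s
      induction s with
      | zero => simp
      | add s s' h h' => simp only [map_add, h, h']
      | tmul x b => simp
    simp only [LinearMap.comp_apply]
    rw [h, ρ.counit_coact]
    simp

theorem extForm_congr [StarHopfAlgebra D] {W : Type*} [AddCommGroup W] [Module ℂ W]
    (B : W →ₗ[ℂ] W →ₗ⋆[ℂ] ℂ) (e : V ≃ₗ[ℂ] W) (s t : V ⊗[ℂ] D) :
    extForm B (e.toLinearMap.rTensor D s) (e.toLinearMap.rTensor D t) =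
      extForm ((B.comp e.toLinearMap).compl₂ e.toLinearMap) s t := by
  induction s with
  | zero => simp
  | add s s' h h' => simp only [map_add, LinearMap.add_apply, h, h']
  | tmul u a =>
    induction t with
    | zero => simp
    | add s s' h h' => simp only [map_add, h, h']
    | tmul v b => simp

theorem IsInvariant.of_congr [StarHopfAlgebra D] {W : Type*} [AddCommGroup W] [Module ℂ W]
    {ρ : RightComodule D V} {e : V ≃ₗ[ℂ] W} {B : W →ₗ[ℂ] W →ₗ⋆[ℂ] ℂ}
    (h : (ρ.congr e).IsInvariant B) :
    ρ.IsInvariant ((B.comp e.toLinearMap).compl₂ e.toLinearMap) := by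
  rw [isInvariant_iff] at h ⊢
  intro u v
  rw [← extForm_congr]
  simpa [congr] using h (e u) (e v)

end RightComodule

/-! ### Orthonormal bases, the spectral theorem and positivity on tensor products. -/

section InnerProduct

variable {V : Type*} [AddCommGroup V] [Module ℂ V] {B : V →ₗ[ℂ] V →ₗ⋆[ℂ] ℂ}

/-- The inner product space structure (conjugate linear in the first variable) defined by a form
which is an inner product linear in the first variable. -/
@[reducible] def IsInnerProduct.core (hB : IsInnerProduct B) : InnerProductSpace.Core ℂ V where
  inner u v := B v u
  conj_inner_symm u v := (hB.1 u v).symm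
  re_inner_nonneg v := by
    by_cases h : v = 0
    · simp [h]
    · exact (hB.2 v h).le
  add_left u v w := map_add _ _ _
  smul_left u v c := (B v).map_smulₛₗ c u
  definite v h := by
    by_contra hv
    simpa [h] using hB.2 v hv

theorem IsInnerProduct.exists_orthonormal (hB : IsInnerProduct B) (Y : Submodule ℂ V)
    [FiniteDimensional ℂ Y] : ∃ (n : ℕ) (y : Fin n → V), (∀ i, y i ∈ Y) ∧
      (∀ i j, B (y i) (y j) = if i = j then 1 else 0) ∧
      ∀ v ∈ Y, ∑ i, B v (y i) • y i = v := by
  let _ : NormedAddCommGroup V := hB.core.toNormedAddCommGroup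
  let _ : InnerProductSpace ℂ V := InnerProductSpace.ofCore hB.core.toCore
  let b := stdOrthonormalBasis ℂ Y
  refine ⟨_, fun i => b i, fun i => (b i).2, fun i j => ?_, fun v hv => ?_⟩
  · have h := orthonormal_iff_ite.1 b.orthonormal j i
    simp only [eq_comm (a := j)] at h
    exact h
  · have h := congrArg (Subtype.val) (b.sum_repr' ⟨v, hv⟩)
    rw [AddSubmonoidClass.coe_finsetSum] at h
    exact h

/-- A Hermitian form `q` is positive definite, or it has an eigenvector with non-positive
eigenvalue with respect to a given inner product. -/
theorem IsInnerProduct.isInnerProduct_or_exists_eigenvector [FiniteDimensional ℂ V]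
    (hB : IsInnerProduct B) (q : V →ₗ[ℂ] V →ₗ⋆[ℂ] ℂ) (hq : ∀ u v, q v u = conj (q u v)) :
    IsInnerProduct q ∨ ∃ r : ℝ, r ≤ 0 ∧ ∃ u : V, u ≠ 0 ∧ ∀ v, q u v = r * B u v := by
  obtain ⟨n, y, -, -, hy⟩ := hB.exists_orthonormal ⊤
  -- `T` represents q through `B`, that is B(Tu, v) = q(u, v). It is self-adjoint because q is
  -- Hermitian, and its eigenvalues decide the alternative.
  let T : V →ₗ[ℂ] V := ∑ i, (q.flip (y i)).smulRight (y i)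
  have hT : ∀ u v, B (T u) v = q u v := by
    intro u v
    conv_rhs => rw [← hy v trivial]
    simp only [T, LinearMap.sum_apply, map_sum, LinearMap.smulRight_apply, LinearMap.flip_apply,
      map_smul, LinearMap.smul_apply, map_smulₛₗ, smul_eq_mul, ← hB.1]
    exact Finset.sum_congr rfl fun i _ => mul_comm _ _
  let _ : NormedAddCommGroup V := hB.core.toNormedAddCommGroup
  let _ : InnerProductSpace ℂ V := InnerProductSpace.ofCore hB.core.toCore
  have hin : ∀ u v : V, inner ℂ u v = B v u := fun _ _ => rfl
  have hsymm : T.IsSymmetric := fun u v => by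
    rw [hin, hin, hT, hB.1, hT, ← hq]
  let b := hsymm.eigenvectorBasis rfl
  let ev := hsymm.eigenvalues rfl
  have hev : ∀ i, T (b i) = (ev i : ℂ) • b i := hsymm.apply_eigenvectorBasis rfl
  by_cases hpos : ∀ i, 0 < ev i
  · refine Or.inl ⟨hq, fun v hv => ?_⟩
    have h1 : q v v = ∑ i, ((ev i * ‖inner ℂ (b i) v‖ ^ 2 : ℝ) : ℂ) := by
      rw [← hT, ← hin, ← b.sum_inner_mul_inner]
      refine Finset.sum_congr rfl fun i _ => ?_
      rw [← hsymm, hev, inner_smul_left, ← inner_conj_symm v (b i)]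
      push_cast
      rw [Complex.conj_ofReal, ← Complex.conj_mul']
      ring
    rw [h1, ← Complex.ofReal_sum, Complex.ofReal_re]
    refine Finset.sum_pos' (fun i _ => mul_nonneg (hpos i).le (sq_nonneg _)) ?_
    by_contra! h
    apply hv
    rw [← b.sum_repr' v]
    refine Finset.sum_eq_zero fun i _ => ?_
    have h2 := h i (Finset.mem_univ i)
    have h3 : ‖inner ℂ (b i) v‖ ^ 2 = 0 :=
      le_antisymm (nonpos_of_mul_nonpos_right h2 (hpos i)) (sq_nonneg _)
    rw [sq_eq_zero_iff, norm_eq_zero] at h3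
    rw [h3, zero_smul]
  · push Not at hpos
    obtain ⟨i, hi⟩ := hpos
    refine Or.inr ⟨ev i, hi, b i, b.orthonormal.ne_zero i, fun v => ?_⟩
    rw [← hT, hev]
    simp

/-- If `h(b* a)` defines an inner product on a finite dimensional `*`-algebra `D`, then for every
inner product on `V` also `(u ⊗ a, v ⊗ b) ↦ ⟨u, v⟩ h(b* a)` is positive definite. -/
theorem IsInnerProduct.extForm_pos {D : Type*} [Ring D] [Algebra ℂ D] [StarRing D]
    [StarModule ℂ D] [FiniteDimensional ℂ D] (hB : IsInnerProduct B) {q : D →ₗ[ℂ] D →ₗ⋆[ℂ] ℂ}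
    (hq : IsInnerProduct q) (h : D →ₗ[ℂ] ℂ) (hqh : ∀ a b, q a b = h (star b * a))
    (s : V ⊗[ℂ] D) (hs : s ≠ 0) : 0 < (h (extForm B s s)).re := by
  obtain ⟨n, y, -, hy1, hy⟩ := hq.exists_orthonormal ⊤
  have h1 : ∀ t : V ⊗[ℂ] D, ∃ c : Fin n → V, t = ∑ i, c i ⊗ₜ[ℂ] y i := by
    intro t
    induction t with
    | zero => exact ⟨0, by simp⟩
    | add t t' h h' =>
      obtain ⟨c, rfl⟩ := h
      obtain ⟨c', rfl⟩ := h'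
      exact ⟨c + c', by simp [TensorProduct.add_tmul, Finset.sum_add_distrib]⟩
    | tmul v d =>
      refine ⟨fun i => q d (y i) • v, ?_⟩
      conv_lhs => rw [← hy d trivial, TensorProduct.tmul_sum]
      simp [TensorProduct.smul_tmul]
  obtain ⟨c, rfl⟩ := h1 s
  -- In an orthonormal basis of `D` the form on V ⊗ D is an orthogonal sum of copies of `B`.
  have h2 : h (extForm B (∑ i, c i ⊗ₜ[ℂ] y i) (∑ i, c i ⊗ₜ[ℂ] y i)) = ∑ i, B (c i) (c i) := by
    simp only [map_sum, LinearMap.sum_apply, extForm_tmul, map_smul, ← hqh, hy1, smul_eq_mul]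
    simp
  rw [h2, Complex.re_sum]
  refine Finset.sum_pos' (fun i _ => hB.core.re_inner_nonneg _) ?_
  by_contra! h3
  apply hs
  refine Finset.sum_eq_zero fun i _ => ?_
  have h4 : c i = 0 := by
    by_contra h5
    exact absurd (hB.2 _ h5) (not_lt.2 (h3 i (Finset.mem_univ i)))
  rw [h4, TensorProduct.zero_tmul]

end InnerProduct

/-! ### The antipode reverses the comultiplication. -/

section AntipodeComul
open HopfAlgebra
variable {R H : Type*} [CommRing R] [Ring H] [HopfAlgebra R H]

theorem cv_id_antipode : cv LinearMap.id (antipode R) = Algebra.linearMap R H ∘ₗ counit := by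
  ext x
  rw [cv_apply _ _ x (ℛ R x)]
  exact sum_mul_antipode_eq_algebraMap_counit (ℛ R x)

theorem cv_antipode_id : cv (antipode R) LinearMap.id = Algebra.linearMap R H ∘ₗ counit := by
  ext x
  rw [cv_apply _ _ x (ℛ R x)]
  exact sum_antipode_mul_eq_algebraMap_counit (ℛ R x)

theorem algHom_comp_unit {B B' : Type*} [Ring B] [Algebra R B] [Ring B'] [Algebra R B']
    (F : B →ₐ[R] B') : F.toLinearMap ∘ₗ Algebra.linearMap R B = Algebra.linearMap R B' := by
  ext; simp

/-- `Δ(S(x)) = ∑ S(x₂) ⊗ S(x₁)` -/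
theorem comul_antipode {ι : Type*} (x : H) (r : Coalgebra.Repr R x ι) :
    comul (antipode R x) = ∑ i ∈ r.index, antipode R (r.right i) ⊗ₜ[R] antipode R (r.left i) := by
  let iL : H →ₐ[R] H ⊗[R] H := Algebra.TensorProduct.includeLeft
  let iR : H →ₐ[R] H ⊗[R] H := Algebra.TensorProduct.includeRight
  let Δ : H →ₐ[R] H ⊗[R] H := Bialgebra.comulAlgHom R H
  let G : H →ₗ[R] H ⊗[R] H :=
    cv (iR.toLinearMap ∘ₗ antipode R) (iL.toLinearMap ∘ₗ antipode R)
  have hΔ : Δ.toLinearMap = cv iL.toLinearMap iR.toLinearMap := by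
    ext y
    rw [cv_apply _ _ y (ℛ R y)]
    simp [iL, iR, Δ, (ℛ R y).eq]
  have hcancel : ∀ F : H →ₐ[R] H ⊗[R] H, cv F.toLinearMap (F.toLinearMap ∘ₗ antipode R) =
      Algebra.linearMap R (H ⊗[R] H) ∘ₗ counit := by
    intro F
    have h := comp_cv F LinearMap.id (antipode R (A := H))
    rw [cv_id_antipode, ← LinearMap.comp_assoc, algHom_comp_unit] at h
    exact h.symm
  -- `G` is a right and Δ ∘ S a left convolution inverse of Δ, so they agree.
  have h1 : cv Δ.toLinearMap G = Algebra.linearMap R (H ⊗[R] H) ∘ₗ counit := by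
    rw [hΔ, cv_assoc, ← cv_assoc iR.toLinearMap, hcancel, one_cv, hcancel]
  have h2 : cv (Δ.toLinearMap ∘ₗ antipode R) Δ.toLinearMap =
      Algebra.linearMap R (H ⊗[R] H) ∘ₗ counit := by
    have h := comp_cv Δ (antipode R (A := H)) LinearMap.id
    rw [cv_antipode_id, ← LinearMap.comp_assoc, algHom_comp_unit] at h
    exact h.symm
  have h3 : Δ.toLinearMap ∘ₗ antipode R = G := by
    rw [← cv_one (Δ.toLinearMap ∘ₗ antipode R), ← h1, ← cv_assoc, h2, one_cv]
  have h4 := LinearMap.congr_fun h3 x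
  simp only [G, cv_apply _ _ x r] at h4
  simpa [Δ, iL, iR] using h4

end AntipodeComul

/-! ### Left and right integrals. -/

section Integral
open HopfAlgebra

variable {R D : Type*} [CommRing R] [Ring D]

/-- `∑ h(x₁) x₂ = h(x) 1` -/
def IsRightIntegral [Bialgebra R D] (h : D →ₗ[R] R) : Prop :=
  ∀ x, TensorProduct.lid R D (h.rTensor D (comul x)) = h x • (1 : D)

/-- `∑ x₁ h(x₂) = h(x) 1` -/
def IsLeftIntegral [Bialgebra R D] (h : D →ₗ[R] R) : Prop :=
  ∀ x, TensorProduct.rid R D (h.lTensor D (comul x)) = h x • (1 : D)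

theorem IsRightIntegral.comp_antipode [HopfAlgebra R D]
    (hS : Function.Injective (antipode R (A := D))) {h : D →ₗ[R] R} (hh : IsRightIntegral h) :
    IsLeftIntegral (h ∘ₗ antipode R) := by
  intro x
  apply hS
  have h1 := hh (antipode R x)
  rw [comul_antipode x (ℛ R x)] at h1
  rw [← (ℛ R x).eq]
  simpa using h1

/-- Evaluate ∑ g(x₁) f(x₂) in two ways, using one integral property at a time. -/
theorem IsLeftIntegral.unique [Bialgebra R D] {f g : D →ₗ[R] R} (hf : IsLeftIntegral f)
    (hg : IsRightIntegral g) (x : D) : f x * g 1 = g x * f 1 := by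
  have h1 : ∀ t : D ⊗[R] D, g (TensorProduct.rid R D (f.lTensor D t)) =
      f (TensorProduct.lid R D (g.rTensor D t)) := by
    intro t
    induction t with
    | zero => simp
    | add s s' h h' => simp only [map_add, h, h']
    | tmul x b => simp [mul_comm]
  have h2 := h1 (comul x)
  rw [hf, hg] at h2
  simpa using h2

end Integral

/-! ### Averaging a form with an integral. -/

section Average

variable {V : Type*} {D E : Type*} [AddCommGroup V] [Module ℂ V]
  [Ring D] [Algebra ℂ D] [StarRing D] [StarModule ℂ D]
  [Ring E] [Algebra ℂ E] [StarRing E] [StarModule ℂ E]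

/-- The form `(u, v) ↦ h(v* u)`. -/
def mulForm (h : D →ₗ[ℂ] ℂ) : D →ₗ[ℂ] D →ₗ⋆[ℂ] ℂ :=
  LinearMap.mk₂'ₛₗ (RingHom.id ℂ) (starRingEnd ℂ) (fun a b => h (star b * a))
    (fun _ _ _ => by rw [mul_add, map_add]) (fun _ _ _ => by simp)
    (fun _ _ _ => by rw [star_add, add_mul, map_add]) (fun _ _ _ => by simp)

theorem mulForm_apply (h : D →ₗ[ℂ] ℂ) (a b : D) : mulForm h a b = h (star b * a) := rfl

/-- The average `(u, v) ↦ ∑ ⟨u₀, v₀⟩ h(v₁* u₁)` of a form. -/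
def avgForm (B : V →ₗ[ℂ] V →ₗ⋆[ℂ] ℂ) (ρ : V →ₗ[ℂ] V ⊗[ℂ] D) (h : D →ₗ[ℂ] ℂ) :
    V →ₗ[ℂ] V →ₗ⋆[ℂ] ℂ :=
  LinearMap.mk₂'ₛₗ (RingHom.id ℂ) (starRingEnd ℂ) (fun u v => h (extForm B (ρ u) (ρ v)))
    (fun _ _ _ => by simp only [map_add, LinearMap.add_apply])
    (fun _ _ _ => by simp only [map_smul, LinearMap.smul_apply, RingHom.id_apply])
    (fun _ _ _ => by simp only [map_add])
    (fun _ _ _ => by rw [map_smul, LinearMap.map_smulₛₗ, map_smul])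

theorem avgForm_apply (B : V →ₗ[ℂ] V →ₗ⋆[ℂ] ℂ) (ρ : V →ₗ[ℂ] V ⊗[ℂ] D) (h : D →ₗ[ℂ] ℂ)
    (u v : V) : avgForm B ρ h u v = h (extForm B (ρ u) (ρ v)) := rfl

/-- Testing an averaged form means applying h to one leg after coacting twice. The second algebra
`E` is independent of `D`: `E` = `D` gives invariance under the averaging coaction, and `E` = `A`
with `D` = `H` gives invariance under the other one. -/
theorem extForm_avgForm (B : V →ₗ[ℂ] V →ₗ⋆[ℂ] ℂ) (ρ : V →ₗ[ℂ] V ⊗[ℂ] D) (h : D →ₗ[ℂ] ℂ)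
    (s t : V ⊗[ℂ] E) : extForm (avgForm B ρ h) s t =
      TensorProduct.lid ℂ E (h.rTensor E (extForm B
        (TensorProduct.assoc ℂ V D E (ρ.rTensor E s))
        (TensorProduct.assoc ℂ V D E (ρ.rTensor E t)))) := by
  have h1 : ∀ (s t : V ⊗[ℂ] D) (a b : E), extForm B (TensorProduct.assoc ℂ V D E (s ⊗ₜ a))
      (TensorProduct.assoc ℂ V D E (t ⊗ₜ b)) = extForm B s t ⊗ₜ (star b * a) := by
    intro s t a b
    induction s with
    | zero => simp
    | add s s' h h' => simp only [map_add, TensorProduct.add_tmul, LinearMap.add_apply, h, h']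
    | tmul u c =>
      induction t with
      | zero => simp
      | add s s' h h' => simp only [map_add, TensorProduct.add_tmul, h, h']
      | tmul v d => simp [TensorProduct.smul_tmul']
  induction s with
  | zero => simp
  | add s s' h h' => simp only [map_add, LinearMap.add_apply, h, h']
  | tmul u a =>
    induction t with
    | zero => simp
    | add s s' h h' => simp only [map_add, h, h']
    | tmul v b =>
      rw [LinearMap.rTensor_tmul, LinearMap.rTensor_tmul, h1]
      simp [avgForm_apply]

/-- By coassociativity and `extForm_lTensor` for Δ, the twice coacted form is Δ of ∑ ⟨u₀, v₀⟩ v₁*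
u₁, and h ⊗ id sends this to a scalar. -/
theorem RightComodule.isInvariant_avgForm {D : Type u} [Ring D] [HopfAlgebra ℂ D]
    [StarHopfAlgebra D] (ρ : RightComodule D V) (B : V →ₗ[ℂ] V →ₗ⋆[ℂ] ℂ) {h : D →ₗ[ℂ] ℂ}
    (hh : IsRightIntegral h) : ρ.IsInvariant (avgForm B ρ.coact h) := by
  rw [isInvariant_iff]
  intro u v
  have h1 := extForm_lTensor B (Bialgebra.comulAlgHom ℂ D) StarHopfAlgebra.comul_star
    (ρ.coact u) (ρ.coact v)
  rw [extForm_avgForm, ρ.coassoc, ρ.coassoc]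
  exact (congrArg (fun t => TensorProduct.lid ℂ D (h.rTensor D t)) h1).trans (hh _)

/-- ∑ ε(v₁* u₁) h(v₂* u₂) = h(v* u). Being an average, this form is invariant whenever h is a right
integral. -/
theorem mulForm_eq_avgForm {D : Type u} [Ring D] [HopfAlgebra ℂ D]
    [StarHopfAlgebra D] (h : D →ₗ[ℂ] ℂ) : mulForm h =
      avgForm (mulForm (counit (R := ℂ) (A := D))) (RightComodule.regular D).coact h := by
  ext u v
  have h1 : ∀ s t : D ⊗[ℂ] D, extForm (mulForm (counit (R := ℂ) (A := D))) s t =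
      star (TensorProduct.lid ℂ D ((counit (R := ℂ) (A := D)).rTensor D t)) *
        TensorProduct.lid ℂ D ((counit (R := ℂ) (A := D)).rTensor D s) := by
    intro s t
    induction s with
    | zero => simp
    | add s s' h h' => simp only [map_add, LinearMap.add_apply, h, h', mul_add]
    | tmul u c =>
      induction t with
      | zero => simp
      | add s s' h h' => simp only [map_add, h, h', star_add, add_mul]
      | tmul v d => simp [mulForm_apply, counit_star, smul_smul, mul_comm (counit (R := ℂ) u)]
  rw [avgForm_apply, h1, mulForm_apply]
  simp [RightComodule.regular]

end Average

/-! ### The Haar functional of a finite compact quantum group. -/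

section Haar
open HopfAlgebra

variable {H : Type v} [Ring H] [HopfAlgebra ℂ H] [StarHopfAlgebra H]

theorem IsRightIntegral.starConj {h : H →ₗ[ℂ] ℂ} (hh : IsRightIntegral h) :
    IsRightIntegral (starConj h) := by
  have h1 : ∀ t : H ⊗[ℂ] H, TensorProduct.lid ℂ H ((QuantumLinkedPair.starConj h).rTensor H t) =
      star (TensorProduct.lid ℂ H (h.rTensor H (star t))) := by
    intro t
    induction t with
    | zero => simp
    | add s s' h h' => simp only [map_add, star_add, h, h']
    | tmul x b => simp [starConj_apply]
  intro x
  rw [h1, ← StarHopfAlgebra.comul_star, hh]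
  simp [starConj_apply]

/-- The slice `∑ φ(x₂) x₁` of `Δ(x)`. -/
def slice (φ : H →ₗ[ℂ] ℂ) : H →ₗ[ℂ] H :=
  (TensorProduct.rid ℂ H).toLinearMap ∘ₗ φ.lTensor H ∘ₗ comul

theorem star_slice (φ : H →ₗ[ℂ] ℂ) (x : H) :
    star (slice φ x) = slice (starConj φ) (star x) := by
  have h1 : ∀ t : H ⊗[ℂ] H, star (TensorProduct.rid ℂ H (φ.lTensor H t)) =
      TensorProduct.rid ℂ H ((starConj φ).lTensor H (star t)) := by
    intro t
    induction t with
    | zero => simp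
    | add s s' h h' => simp only [map_add, star_add, h, h']
    | tmul x b => simp [starConj_apply]
  simp only [slice, LinearMap.comp_apply, LinearEquiv.coe_coe, h1, StarHopfAlgebra.comul_star]

/-- As a consequence, ε cannot vanish on a nonzero subspace closed under all slices. -/
theorem counit_slice (φ : H →ₗ[ℂ] ℂ) (x : H) : counit (R := ℂ) (slice φ x) = φ x := by
  have h1 : ∀ t : H ⊗[ℂ] H, counit (R := ℂ) (TensorProduct.rid ℂ H (φ.lTensor H t)) =
      φ (TensorProduct.lid ℂ H ((counit (R := ℂ) (A := H)).rTensor H t)) := by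
    intro t
    induction t with
    | zero => simp
    | add s s' h h' => simp only [map_add, h, h']
    | tmul x b => simp [mul_comm]
  simp only [slice, LinearMap.comp_apply, LinearEquiv.coe_coe, h1]
  simp

/-- Expansion of `Δ(x)` in an orthonormal family of a subspace containing all slices. -/
theorem comul_eq_sum_of_slice_mem [FiniteDimensional ℂ H] {B : H →ₗ[ℂ] H →ₗ⋆[ℂ] ℂ} {n : ℕ}
    {y : Fin n → H} {Y : Submodule ℂ H} (hy : ∀ v ∈ Y, ∑ i, B v (y i) • y i = v) (x : H)
    (hx : ∀ φ, slice φ x ∈ Y) :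
    comul (R := ℂ) x = ∑ i, y i ⊗ₜ[ℂ]
      TensorProduct.lid ℂ H ((B.flip (y i)).rTensor H (comul x)) := by
  let b := Module.finBasis ℂ H
  have h1 : ∀ t : H ⊗[ℂ] H,
      t = ∑ l, TensorProduct.rid ℂ H ((b.coord l).lTensor H t) ⊗ₜ[ℂ] b l := by
    intro t
    induction t with
    | zero => simp
    | add s s' h h' =>
      simp only [map_add, TensorProduct.add_tmul, Finset.sum_add_distrib]
      rw [← h, ← h']
    | tmul u c =>
      conv_lhs => rw [← b.sum_repr c, TensorProduct.tmul_sum]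
      simp [TensorProduct.smul_tmul]
  have h2 : comul (R := ℂ) x = ∑ l, slice (b.coord l) x ⊗ₜ[ℂ] b l := h1 _
  conv_rhs => rw [h2]
  simp only [map_sum, LinearMap.rTensor_tmul, TensorProduct.lid_tmul, TensorProduct.tmul_sum,
    LinearMap.flip_apply, ← TensorProduct.smul_tmul]
  rw [Finset.sum_comm, h2]
  refine Finset.sum_congr rfl fun l _ => ?_
  rw [← TensorProduct.sum_tmul, hy _ (hx _)]

/-- If the orthonormal family `y` spans a subcomodule, then `∑ yᵢ yᵢ*` is a scalar. -/
theorem sum_mul_star_eq_counit_smul [FiniteDimensional ℂ H] {B : H →ₗ[ℂ] H →ₗ⋆[ℂ] ℂ}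
    (hB : (RightComodule.regular H).IsInvariant B) {n : ℕ}
    {y : Fin n → H} (hortho : ∀ i j, B (y i) (y j) = if i = j then 1 else 0)
    (U : Matrix (Fin n) (Fin n) H) (hU : ∀ j, comul (R := ℂ) (y j) = ∑ i, y i ⊗ₜ[ℂ] U i j) :
    ∑ i, y i * star (y i) = counit (R := ℂ) (∑ i, y i * star (y i)) • (1 : H) := by
  -- Needed for `mul_eq_one_comm` below: invariance gives only U* U = 1, and over a Noetherian ring
  -- a one-sided inverse of a square matrix is two-sided.
  have : IsNoetherianRing H := isNoetherian_of_tower ℂ inferInstance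
  have h1 : U.conjTranspose * U = 1 := by
    ext j i
    have h := (RightComodule.isInvariant_iff _ _).1 hB (y i) (y j)
    change extForm B (comul (y i)) (comul (y j)) = _ at h
    rw [hU, hU] at h
    simp only [map_sum, LinearMap.sum_apply, extForm_tmul, hortho] at h
    simp only [ite_smul, one_smul, zero_smul, Finset.sum_ite_eq', Finset.mem_univ, if_true] at h
    rw [Matrix.mul_apply, Matrix.one_apply]
    simpa [Matrix.conjTranspose_apply, eq_comm] using h
  have h2 : U * U.conjTranspose = 1 := mul_eq_one_comm.1 h1
  have hrow : ∀ i k, ∑ j, U i j * star (U k j) = if i = k then 1 else 0 := fun i k => by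
    rw [← Matrix.one_apply, ← h2, Matrix.mul_apply]
    rfl
  -- Orthonormality of the rows of `U` makes the sum coinvariant; applying ε to the first leg then
  -- shows that it is a scalar.
  have h3 : comul (R := ℂ) (∑ i, y i * star (y i)) = (∑ i, y i * star (y i)) ⊗ₜ[ℂ] 1 := by
    simp only [map_sum, Bialgebra.comul_mul, StarHopfAlgebra.comul_star, hU, star_sum,
      TensorProduct.star_tmul, Finset.sum_mul_sum, Algebra.TensorProduct.tmul_mul_tmul]
    rw [Finset.sum_comm, TensorProduct.sum_tmul]
    refine Finset.sum_congr rfl fun i _ => ?_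
    rw [Finset.sum_comm]
    simp only [← TensorProduct.tmul_sum, hrow]
    rw [Finset.sum_eq_single i (fun k _ hk => by simp [Ne.symm hk]) (by simp), if_pos rfl]
  have h4 := Coalgebra.rTensor_counit_comul (R := ℂ) (∑ i, y i * star (y i))
  rw [h3, LinearMap.rTensor_tmul] at h4
  have h5 := congrArg (TensorProduct.lid ℂ H) h4
  rw [TensorProduct.lid_tmul, TensorProduct.lid_tmul, one_smul] at h5
  exact h5.symm

/-- `IsCQG` speaks of comodules in universe `w`, while `H` lives in `v`. Finite dimension allows the
regular comodule to be transported to a lifted coordinate space. -/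
theorem IsCQG.exists_invariant_regular (hH : IsCQG.{v, w} H) [FiniteDimensional ℂ H] :
    ∃ B : H →ₗ[ℂ] H →ₗ⋆[ℂ] ℂ, IsInnerProduct B ∧ (RightComodule.regular H).IsInvariant B := by
  let e : H ≃ₗ[ℂ] ULift.{w} (Fin (Module.finrank ℂ H) → ℂ) :=
    (Module.finBasis ℂ H).equivFun ≪≫ₗ ULift.moduleEquiv.symm
  obtain ⟨B, hB, hinv⟩ := hH _ ((RightComodule.regular H).congr e)
  refine ⟨_, ⟨fun u v => hB.1 _ _, fun v hv => hB.2 (e v) ?_⟩, hinv.of_congr⟩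
  simpa using hv

/-- Since Δ(1) = 1 ⊗ 1, invariance against v = 1 reads ∑ ⟨x₁, 1⟩ S(x₂) = ⟨x, 1⟩ 1, and S is
injective. Thus ⟨·, 1⟩ / ⟨1, 1⟩ is the integral. -/
theorem exists_rightIntegral {B : H →ₗ[ℂ] H →ₗ⋆[ℂ] ℂ} (hB : IsInnerProduct B)
    (hinv : (RightComodule.regular H).IsInvariant B) :
    ∃ h : H →ₗ[ℂ] ℂ, IsRightIntegral h ∧ h 1 = 1 := by
  have h1 : (1 : H) ≠ 0 := fun h => by
    have := congrArg (counit (R := ℂ)) h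
    simp at this
  have h2 : B 1 1 ≠ 0 := fun h => by simpa [h] using hB.2 1 h1
  refine ⟨(B 1 1)⁻¹ • B.flip 1, fun x => ?_, by simp [h2]⟩
  apply antipode_bijective.1
  have h3 := hinv x 1
  have h4 : ∀ t : H ⊗[ℂ] H, antipode ℂ (TensorProduct.lid ℂ H ((B.flip 1).rTensor H t)) =
      TensorProduct.lid ℂ H (TensorProduct.map (B.flip 1) (antipode ℂ) t) := by
    intro t
    induction t with
    | zero => simp
    | add s s' h h' => simp only [map_add, h, h']
    | tmul x b => simp
  have h5 : antipode ℂ (TensorProduct.lid ℂ H ((B.flip 1).rTensor H (comul x))) =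
      B x 1 • (1 : H) := by
    rw [h4]
    refine h3.trans ?_
    simp [RightComodule.regular, Algebra.TensorProduct.one_def]
  simp [LinearMap.rTensor_smul, h5, smul_smul]

/-- Otherwise h(v* u) has an eigenvector, relative to `B`, with eigenvalue r ≤ 0. For a
`B`-orthonormal basis y of the star of its eigenspace, z = ∑ yᵢ yᵢ* is a scalar, so h(z) = ε(z) = ∑
|ε(yᵢ)|² ≥ 0. On the other hand h(z) = r ∑ ⟨yᵢ*, yᵢ*⟩ ≤ 0. Hence ε kills a nonzero subcomodule,
contradicting `counit_slice`. -/
theorem isInnerProduct_mulForm [FiniteDimensional ℂ H] {B : H →ₗ[ℂ] H →ₗ⋆[ℂ] ℂ}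
    (hB : IsInnerProduct B) (hinv : (RightComodule.regular H).IsInvariant B)
    {h : H →ₗ[ℂ] ℂ} (hh : IsRightIntegral h) (h1 : h 1 = 1)
    (hstar : ∀ x, h (star x) = conj (h x)) : IsInnerProduct (mulForm h) := by
  rcases hB.isInnerProduct_or_exists_eigenvector (mulForm h)
    (fun u v => by simp [mulForm_apply, ← hstar]) with hpos | ⟨r, hr, u, hu, hq⟩
  · exact hpos
  exfalso
  have hqinv : (RightComodule.regular H).IsInvariant (mulForm h) := by
    rw [mulForm_eq_avgForm]
    exact RightComodule.isInvariant_avgForm _ _ hh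
  -- The eigenspace for r. It is a subcomodule since both forms are invariant: the difference form k
  -- satisfies ∑ k(x₁, v) S(x₂) = ∑ k(x, v₁) v₂* = 0 for x in `E`.
  let E : Submodule ℂ H := LinearMap.ker (mulForm h - (r : ℂ) • B)
  have hE : ∀ {x}, x ∈ E ↔ mulForm h x = (r : ℂ) • B x := by
    intro x
    rw [LinearMap.mem_ker, LinearMap.sub_apply, sub_eq_zero, LinearMap.smul_apply]
  have hEs : ∀ x ∈ E, ∀ φ, slice φ x ∈ E := by
    intro x hx φ
    rw [hE] at hx ⊢
    ext v
    let k : H →ₗ[ℂ] ℂ := (mulForm h).flip v - (r : ℂ) • B.flip v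
    have e1 : ∀ t : H ⊗[ℂ] H, antipode ℂ (TensorProduct.lid ℂ H (k.rTensor H t)) =
        TensorProduct.lid ℂ H (TensorProduct.map ((mulForm h).flip v) (antipode ℂ) t) -
        (r : ℂ) • TensorProduct.lid ℂ H (TensorProduct.map (B.flip v) (antipode ℂ) t) := by
      intro t
      induction t with
      | zero => simp
      | add s s' h h' => simp only [map_add, h, h', smul_add]; abel
      | tmul x b => simp [k, smul_smul]
    have e2 : TensorProduct.lid ℂ H (k.rTensor H (comul x)) = 0 := by
      apply antipode_bijective.1
      rw [e1, map_zero]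
      have e3 := hqinv x v
      have e4 := hinv x v
      simp only [RightComodule.regular] at e3 e4
      rw [e3, e4, hx, TensorProduct.map_smul_left, LinearMap.smul_apply, map_smul, sub_self]
    have e3 : ∀ t : H ⊗[ℂ] H, k (TensorProduct.rid ℂ H (φ.lTensor H t)) =
        φ (TensorProduct.lid ℂ H (k.rTensor H t)) := by
      intro t
      induction t with
      | zero => simp
      | add s s' h h' => simp only [map_add, h, h']
      | tmul x b => simp [mul_comm]
    have e4 : k (slice φ x) = 0 := by
      refine (e3 _).trans ?_
      rw [e2, map_zero]
    simpa [k, sub_eq_zero] using e4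
  -- The stars of `E`: the row relations of the unitary matrix control ∑ y y*, and h(y y*) is the
  -- value of the form h(v* u) at y*.
  let Y : Submodule ℂ H :=
    { carrier := {y | star y ∈ E}
      add_mem' := fun {a b} ha hb => by
        simpa only [Set.mem_ofPred_eq, star_add] using E.add_mem ha hb
      zero_mem' := by simp
      smul_mem' := fun c x hx => by
        simpa only [Set.mem_ofPred_eq, star_smul] using E.smul_mem (star c) hx }
  have hY : ∀ {y}, y ∈ Y ↔ star y ∈ E := Iff.rfl
  have hYs : ∀ y ∈ Y, ∀ φ, slice φ y ∈ Y := fun y hy φ => by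
    rw [hY, star_slice]
    exact hEs _ hy _
  obtain ⟨n, y, hyY, hortho, hy⟩ := hB.exists_orthonormal Y
  have hz := sum_mul_star_eq_counit_smul hinv hortho
    (fun i j => TensorProduct.lid ℂ H ((B.flip (y i)).rTensor H (comul (y j))))
    (fun j => comul_eq_sum_of_slice_mem hy (y j) (hYs _ (hyY j)))
  have hz1 := congrArg h hz
  rw [map_smul, h1, smul_eq_mul, mul_one] at hz1
  have hz2 : h (∑ i, y i * star (y i)) = r * ∑ i, B (star (y i)) (star (y i)) := by
    rw [map_sum, Finset.mul_sum]
    refine Finset.sum_congr rfl fun i _ => ?_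
    have := LinearMap.congr_fun (hE.1 (hY.1 (hyY i))) (star (y i))
    simpa [mulForm_apply] using this
  have hz3 : counit (R := ℂ) (∑ i, y i * star (y i)) =
      ((∑ i, Complex.normSq (counit (R := ℂ) (y i)) : ℝ) : ℂ) := by
    simp [counit_star, Complex.mul_conj]
  have hle : ∑ i, Complex.normSq (counit (R := ℂ) (y i)) ≤ 0 := by
    have e := congrArg Complex.re (hz3.symm.trans (hz1.symm.trans hz2))
    rw [Complex.ofReal_re, Complex.re_ofReal_mul, Complex.re_sum] at e
    rw [e]
    exact mul_nonpos_of_nonpos_of_nonneg hr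
      (Finset.sum_nonneg fun i _ => hB.core.re_inner_nonneg _)
  have hε : ∀ i, counit (R := ℂ) (y i) = 0 := by
    intro i
    rw [← Complex.normSq_eq_zero]
    exact le_antisymm ((Finset.single_le_sum (f := fun i => Complex.normSq (counit (R := ℂ) (y i)))
      (fun j _ => Complex.normSq_nonneg _) (Finset.mem_univ i)).trans hle) (Complex.normSq_nonneg _)
  have hεY : ∀ v ∈ Y, counit (R := ℂ) v = 0 := by
    intro v hv
    rw [← hy v hv]
    simp [hε]
  have huY : star u ∈ Y := by
    rw [hY, star_star, hE]
    ext v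
    exact hq v
  apply hu
  rw [← star_eq_zero, ← Module.forall_dual_apply_eq_zero_iff ℂ (star u)]
  intro φ
  rw [← counit_slice]
  exact hεY _ (hYs _ huY φ)

/-- A finite compact quantum group has a positive definite normalized two-sided integral. -/
theorem IsCQG.exists_haar (hH : IsCQG.{v, w} H) [FiniteDimensional ℂ H] :
    ∃ h : H →ₗ[ℂ] ℂ, IsRightIntegral h ∧ IsLeftIntegral h ∧ h 1 = 1 ∧
      (∀ x, h (star x) = conj (h x)) ∧ IsInnerProduct (mulForm h) := by
  obtain ⟨B, hB, hinv⟩ := hH.exists_invariant_regular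
  obtain ⟨h, hh, h1⟩ := exists_rightIntegral hB hinv
  have hl := hh.comp_antipode antipode_bijective.1
  -- The left integral h ∘ S is compared with two right integrals, h and x ↦ conj h(x*), each with
  -- value 1 at 1. The first comparison makes h two-sided, and both together make it Hermitian.
  have e1 : h ∘ₗ antipode ℂ = h := by
    ext x
    simpa [h1] using hl.unique hh x
  have e2 : h ∘ₗ antipode ℂ = starConj h := by
    ext x
    simpa [h1, starConj_apply] using hl.unique hh.starConj x
  have hstar : ∀ x, h (star x) = conj (h x) := by
    intro x
    have := LinearMap.congr_fun (e1.symm.trans e2) (star x)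
    simpa [starConj_apply] using this
  rw [e1] at hl
  exact ⟨h, hh, hl, h1, hstar, isInnerProduct_mulForm hB hinv hh h1 hstar⟩

end Haar
namespace LinkedPair
open HopfAlgebra

/-! ### Integrals of `H` and the coaction ρ. -/

section Coaction
variable {A : Type u} {H : Type v} [Ring A] [Ring H] [HopfAlgebra ℂ A] [HopfAlgebra ℂ H]
  [StarHopfAlgebra A] (P : LinkedPair ℂ A H)

/-- An integral of `H` is invariant under the coaction: `∑ h(x_H) x_A = h(x) 1`. -/
theorem lid_rTensor_coact {h : H →ₗ[ℂ] ℂ} (hr : IsRightIntegral h) (hl : IsLeftIntegral h)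
    (h₁ : h 1 = 1) (x : H) : TensorProduct.lid ℂ A (h.rTensor A (P.coact x)) = h x • (1 : A) := by
  -- Applying h to the first leg of `comul_coact` gives 1 ⊗ g(x) = ∑ (1 ⊗ g(x₁)) ρ(x₂). After
  -- removal of ρ by `Θ`, this becomes ∑ x₂ ⊗ g(x₁), and h as a left integral gives g(x) = h(x)
  -- g(1).
  let g : H →ₗ[ℂ] A := (TensorProduct.lid ℂ A).toLinearMap ∘ₗ h.rTensor A ∘ₗ P.coact
  let K : (H ⊗[ℂ] H) ⊗[ℂ] A →ₗ[ℂ] H ⊗[ℂ] A :=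
    ((TensorProduct.lid ℂ H).toLinearMap ∘ₗ h.rTensor H).rTensor A
  have h1 : ∀ t : H ⊗[ℂ] A, K ((comul (R := ℂ) (A := H)).rTensor A t) =
      1 ⊗ₜ TensorProduct.lid ℂ A (h.rTensor A t) := by
    intro t
    induction t with
    | zero => simp
    | add s s' h h' => simp only [map_add, h, h', TensorProduct.tmul_add]
    | tmul x a =>
      simp only [K, LinearMap.rTensor_tmul, LinearMap.comp_apply, LinearEquiv.coe_coe, hr x,
        TensorProduct.lid_tmul, TensorProduct.smul_tmul]
  have h2 : ∀ t t' : H ⊗[ℂ] A, K ((LinearMap.mul' ℂ A).lTensor (H ⊗[ℂ] H)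
      (TensorProduct.tensorTensorTensorComm ℂ H A H A (t ⊗ₜ t'))) =
      (1 ⊗ₜ TensorProduct.lid ℂ A (h.rTensor A t)) * t' := by
    intro t t'
    induction t with
    | zero => simp
    | add s s' h h' => simp only [map_add, h, h', TensorProduct.tmul_add, TensorProduct.add_tmul,
        add_mul]
    | tmul x a =>
      induction t' with
      | zero => simp
      | add s s' h h' => simp only [map_add, h, h', TensorProduct.tmul_add, mul_add]
      | tmul y b => simp [K, TensorProduct.smul_tmul]
  -- `Θ`(y ⊗ a) = ∑ y_H ⊗ a S⁻¹(y_A), a left `A`-linear map with `Θ`(ρ(y)) = y ⊗ 1.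
  let Θ : H ⊗[ℂ] A →ₗ[ℂ] H ⊗[ℂ] A :=
    (LinearMap.mul' ℂ A ∘ₗ (TensorProduct.comm ℂ A A).toLinearMap ∘ₗ
      (antipodeInv A).rTensor A).lTensor H ∘ₗ (TensorProduct.assoc ℂ H A A).toLinearMap ∘ₗ
        P.coact.rTensor A
  have h3 : ∀ (b : A) (t : H ⊗[ℂ] A), Θ ((1 ⊗ₜ b) * t) = (1 ⊗ₜ b) * Θ t := by
    intro b t
    induction t with
    | zero => simp
    | add s s' h h' => simp only [map_add, h, h', mul_add]
    | tmul x a =>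
      simp only [Θ, LinearMap.comp_apply, Algebra.TensorProduct.tmul_mul_tmul, one_mul,
        LinearMap.rTensor_tmul]
      induction P.coact x with
      | zero => simp
      | add s s' h h' => simp only [map_add, TensorProduct.add_tmul, h, h', mul_add]
      | tmul y c => simp [mul_assoc]
  have h4 : ∀ t : H ⊗[ℂ] A, (LinearMap.mul' ℂ A ∘ₗ (TensorProduct.comm ℂ A A).toLinearMap ∘ₗ
      (antipodeInv A).rTensor A).lTensor H ((comul (R := ℂ) (A := A)).lTensor H t) =
      TensorProduct.rid ℂ H ((counit (R := ℂ) (A := A)).lTensor H t) ⊗ₜ 1 := by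
    intro t
    induction t with
    | zero => simp
    | add s s' h h' => simp only [map_add, h, h', TensorProduct.add_tmul]
    | tmul x a =>
      have e := LinearMap.congr_fun (bcv_antipodeInv_id (H := A)) a
      rw [bcv_apply _ _ _ a (ℛ ℂ a)] at e
      rw [LinearMap.lTensor_tmul, LinearMap.lTensor_tmul, ← (ℛ ℂ a).eq]
      simp only [map_sum, LinearMap.comp_apply, LinearEquiv.coe_coe, LinearMap.rTensor_tmul,
        TensorProduct.comm_tmul, LinearMap.mul'_apply]
      simp only [LinearMap.flip_apply, LinearMap.mul_apply', LinearMap.id_apply] at e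
      rw [e]
      simp [TensorProduct.smul_tmul]
  have h5 : ∀ y, Θ (P.coact y) = y ⊗ₜ 1 := by
    intro y
    simp only [Θ, LinearMap.comp_apply, LinearEquiv.coe_coe]
    rw [P.coact_coact, h4, P.coact_counit]
  have h6 : (1 : H) ⊗ₜ[ℂ] g x =
      ∑ i ∈ (ℛ ℂ x).index, (1 ⊗ₜ g ((ℛ ℂ x).left i)) * P.coact ((ℛ ℂ x).right i) := by
    have e := congrArg K (P.comul_coact x)
    rw [h1, ← (ℛ ℂ x).eq] at e
    simp only [map_sum, TensorProduct.map_tmul, h2] at e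
    exact e
  have h7 := congrArg (fun t => TensorProduct.lid ℂ A (h.rTensor A (Θ t))) h6
  have h8 := h3 (g x) 1
  rw [Algebra.TensorProduct.one_def, ← P.coact_one, h5, P.coact_one,
    Algebra.TensorProduct.tmul_mul_tmul, one_mul, mul_one] at h8
  simp only [map_sum, h3, h5, h8, Algebra.TensorProduct.tmul_mul_tmul, one_mul, mul_one,
    LinearMap.rTensor_tmul, TensorProduct.lid_tmul] at h7
  have h9 := hl x
  rw [← (ℛ ℂ x).eq] at h9
  simp only [map_sum, LinearMap.lTensor_tmul, TensorProduct.rid_tmul] at h9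
  simp only [← map_smul, ← map_sum, h9] at h7
  have h10 : g 1 = h 1 • (1 : A) := by
    simp [g, P.coact_one]
  have h11 : g (h x • 1) = h x • (1 : A) := by rw [g.map_smul, h10, h₁, one_smul]
  rw [h11, h₁, one_smul] at h7
  exact h7

end Coaction

/-! ### H ⊗ A as a module algebra over `H`, and the star of the coaction. -/

section Twist
variable {R : Type*} {A : Type u} {H : Type v} [CommRing R] [Ring A] [Ring H]
  [Bialgebra R A] [Bialgebra R H] (P : LinkedPair R A H)

theorem actT_mul {ι : Type*} (s t : H ⊗[R] A) (y : H) (r : Coalgebra.Repr R y ι) :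
    P.actT (s * t) y = ∑ i ∈ r.index, P.actT s (r.left i) * P.actT t (r.right i) := by
  have h0 : ∀ a b, P.act y (a * b) =
      ∑ i ∈ r.index, P.act (r.left i) a * P.act (r.right i) b := by
    intro a b
    have e := congrArg (TensorProduct.lift ((LinearMap.mul R A).compl₁₂ (P.act.flip a)
      (P.act.flip b))) ((ℛ R y).eq.trans r.eq.symm)
    rw [P.act_mul]
    simpa using e
  induction s with
  | zero => simp
  | add s s' h h' => simp only [map_add, add_mul, LinearMap.add_apply, h, h',
      Finset.sum_add_distrib]
  | tmul x a =>
    induction t with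
    | zero => simp
    | add s s' h h' => simp only [map_add, mul_add, LinearMap.add_apply, h, h',
        Finset.sum_add_distrib]
    | tmul z b => simp [actT_apply, h0, TensorProduct.tmul_sum]

/-- The action distributes over products by `actT_mul`, and coassociativity regroups the legs. -/
theorem bcv_actT_mulRight (t : H ⊗[R] A) (f : H →ₗ[R] H ⊗[R] A) :
    bcv P.actT (LinearMap.mulRight R t ∘ₗ f) LinearMap.id =
      cv (bcv P.actT f LinearMap.id) (P.actT t) := by
  let β₂ : H ⊗[R] A →ₗ[R] H ⊗[R] H →ₗ[R] H ⊗[R] A :=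
    (TensorProduct.lift.equiv (RingHom.id R) H H (H ⊗[R] A)).toLinearMap ∘ₗ
      (LinearMap.llcomp R H (H ⊗[R] A) (H →ₗ[R] H ⊗[R] A)
        ((LinearMap.mul R (H ⊗[R] A)).compl₂ (P.actT t))) ∘ₗ P.actT
  have hβ : ∀ m y z, β₂ m (y ⊗ₜ z) = P.actT m y * P.actT t z := fun m y z => rfl
  have h2 : bcv (TensorProduct.mk R H H) LinearMap.id LinearMap.id = (comul : H →ₗ[R] _) := by
    ext x
    rw [bcv_apply _ _ _ x (ℛ R x), ← (ℛ R x).eq]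
    rfl
  have h3 : cv (bcv P.actT f LinearMap.id) (P.actT t) =
      bcv ((LinearMap.mul R (H ⊗[R] A)).compl₂ (P.actT t)) (bcv P.actT f LinearMap.id)
        LinearMap.id := by
    rw [cv_eq_bcv]
    rfl
  rw [h3, bcv_assoc _ _ β₂ (TensorProduct.mk R H H) (fun a b c => rfl), h2]
  ext1 x
  rw [bcv_apply _ _ _ x (ℛ R x), bcv_apply _ _ _ x (ℛ R x)]
  refine Finset.sum_congr rfl fun i _ => ?_
  rw [← (ℛ R ((ℛ R x).right i)).eq, map_sum]
  simp only [hβ]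
  exact P.actT_mul _ _ _ (ℛ R _)

end Twist

section StarCoaction
variable {A : Type u} {H : Type v} [Ring A] [Ring H] [HopfAlgebra ℂ A] [HopfAlgebra ℂ H]
  [StarHopfAlgebra A] [StarHopfAlgebra H] (P : LinkedPair ℂ A H)

/-- Inserting `hρ` into ρ(yx) = ∑ ρ(y₁)(y₂ ▶ ρ(x)) gives ρ(yx) = ∑ y₂ ▶ (ρ(y₁*)* ρ(x)); convolving
with S⁻¹ undoes the action. -/
theorem starConj_coact_mul (hρ : P.coact = bcv P.actT (starConj P.coact) LinearMap.id) (x : H) :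
    LinearMap.mulRight ℂ (P.coact x) ∘ₗ starConj P.coact =
      bcv P.actT (P.coact ∘ₗ LinearMap.mulRight ℂ x) (antipodeInv H) := by
  have h1 : P.coact ∘ₗ LinearMap.mulRight ℂ x = cv P.coact (P.actT (P.coact x)) :=
    P.coact_mulRight x
  have h2 : cv P.coact (P.actT (P.coact x)) = bcv P.actT
      (LinearMap.mulRight ℂ (P.coact x) ∘ₗ starConj P.coact) LinearMap.id := by
    rw [bcv_actT_mulRight, ← hρ]
  rw [h1, h2]
  exact (bcv_bcv_cancel P.actT (LinearMap.mul ℂ H).flip 1 (fun a b c => P.actT_actT a b c)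
    P.actT_one _ _ bcv_id_antipodeInv _).symm

/-- By `starConj_coact_mul` the product is ∑ S⁻¹(z₂) ▶ ρ(z₁ x) with z = y*. Since h ⊗ id commutes
with the action, and ∑ h(w_H) w_A = h(w) 1, each S⁻¹(z₂) acts on a multiple of 1 and hence by its
counit. -/
theorem lid_rTensor_star_coact_mul (hρ : P.coact = bcv P.actT (starConj P.coact) LinearMap.id)
    {h : H →ₗ[ℂ] ℂ} (hr : IsRightIntegral h) (hl : IsLeftIntegral h) (h₁ : h 1 = 1) (x y : H) :
    TensorProduct.lid ℂ A (h.rTensor A (star (P.coact y) * P.coact x)) =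
      h (star y * x) • (1 : A) := by
  have h1 := LinearMap.congr_fun (P.starConj_coact_mul hρ x) (star y)
  rw [LinearMap.comp_apply, LinearMap.mulRight_apply, starConj_apply, star_star] at h1
  have h2 : ∀ (t : H ⊗[ℂ] A) (z : H), TensorProduct.lid ℂ A (h.rTensor A (P.actT t z)) =
      P.act z (TensorProduct.lid ℂ A (h.rTensor A t)) := by
    intro t z
    induction t with
    | zero => simp
    | add s s' h h' => simp only [map_add, LinearMap.add_apply, h, h']
    | tmul x a => simp [actT_apply]
  have h3 := congrArg (TensorProduct.lift (LinearMap.lsmul ℂ ℂ).flip ∘ₗ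
    TensorProduct.map (h ∘ₗ LinearMap.mulRight ℂ x) LinearMap.id)
    (Coalgebra.sum_tmul_counit_eq (ℛ ℂ (star y)))
  simp only [map_sum, LinearMap.comp_apply, TensorProduct.map_tmul, TensorProduct.lift.tmul] at h3
  have h4 : ∀ z, counit (R := ℂ) (antipodeInv H z) = counit (R := ℂ) z := fun z => by
    rw [← counit_antipode, antipode_antipodeInv]
  rw [h1, bcv_apply _ _ _ _ (ℛ ℂ (star y)), map_sum, map_sum]
  simp only [h2, LinearMap.comp_apply, P.lid_rTensor_coact hr hl h₁, map_smul, P.act_one, h4,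
    Algebra.algebraMap_eq_smul_one, smul_smul, ← Finset.sum_smul]
  congr 1
  simpa [mul_comm] using h3

end StarCoaction

/-! ### The projections are coalgebra maps. -/

section Projections
variable {R : Type*} {A : Type u} {H : Type v} [CommRing R] [Ring A] [Ring H]
  [Bialgebra R A] [Bialgebra R H] (P : LinkedPair R A H)

/-- A pair of linear maps on `A # H`, applied to `Δ(a # x)`. -/
theorem map_comul_tm {M N : Type*} [AddCommMonoid M] [Module R M] [AddCommMonoid N] [Module R N]
    (F : P.Bismash →ₗ[R] M) (G : P.Bismash →ₗ[R] N) (a : A) (x : H) :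
    TensorProduct.map F G (comul (P.tm a x)) =
      ∑ j ∈ (ℛ R a).index, ∑ i ∈ (ℛ R x).index,
        TensorProduct.map (F ∘ₗ P.tm ((ℛ R a).left j))
          (G ∘ₗ P.tm.flip ((ℛ R x).right i) ∘ₗ LinearMap.mulLeft R ((ℛ R a).right j))
          (P.coact ((ℛ R x).left i)) := by
  have h1 : ∀ (c d : A) (t : H ⊗[R] A) (y : H),
      TensorProduct.map F G (P.jA (c ⊗ₜ d) * (P.jK t * P.jQ y)) =
      TensorProduct.map (F ∘ₗ P.tm c) (G ∘ₗ P.tm.flip y ∘ₗ LinearMap.mulLeft R d) t := by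
    intro c d t y
    induction t with
    | zero => simp
    | add s s' h h' => simp only [map_add, add_mul, mul_add, h, h']
    | tmul x a =>
      rw [jA_tmul, jK_tmul, jQ_apply, Algebra.TensorProduct.tmul_mul_tmul,
        Algebra.TensorProduct.tmul_mul_tmul, mul_one, inA_mul_inH, inA_mul_inH, inA_mul, leftA_tm]
      rfl
  rw [comul_tm, comulH, cv_apply _ _ x (ℛ R x), ← (ℛ R a).eq]
  simp only [map_sum, Finset.sum_mul_sum, LinearMap.comp_apply, AlgHom.toLinearMap_apply, h1]

theorem sum_counit_smul_left {C ι : Type*} [AddCommGroup C] [Module R C] [Coalgebra R C] (x : C)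
    (r : Coalgebra.Repr R x ι) : ∑ i ∈ r.index, counit (R := R) (r.right i) • r.left i = x := by
  have h := congrArg (TensorProduct.rid R C) (Coalgebra.sum_tmul_counit_eq r)
  simp only [map_sum, TensorProduct.rid_tmul, one_smul] at h
  exact h

theorem sum_counit_mul_counit {C ι : Type*} [AddCommGroup C] [Module R C] [Coalgebra R C] (x : C)
    (r : Coalgebra.Repr R x ι) :
    ∑ i ∈ r.index, counit (R := R) (r.right i) * counit (R := R) (r.left i) =
      counit (R := R) x := by
  have h := congrArg (counit (R := R)) (sum_counit_smul_left x r)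
  simpa using h

theorem comul_piA (m : P.Bismash) :
    comul (R := R) (P.piA m) = TensorProduct.map P.piA P.piA (comul m) := by
  induction m using P.induction_on with
  | h0 => simp
  | ha m n hm hn => simp only [map_add, hm, hn]
  | h a x =>
    have h1 : ∀ (c d : A) (y : H) (t : H ⊗[R] A), TensorProduct.map (P.piA ∘ₗ P.tm c)
        (P.piA ∘ₗ P.tm.flip y ∘ₗ LinearMap.mulLeft R d) t = counit (R := R) y •
          c ⊗ₜ (d * TensorProduct.lid R A ((counit (R := R) (A := H)).rTensor A t)) := by
      intro c d y t
      induction t with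
      | zero => simp
      | add s s' h h' => simp only [map_add, mul_add, TensorProduct.tmul_add, smul_add, h, h']
      | tmul z b => simp [piA_tm, TensorProduct.smul_tmul, smul_comm (counit (R := R) y)]
    simp only [map_comul_tm, h1, P.counit_coact, Algebra.algebraMap_eq_smul_one, mul_smul_comm,
      mul_one, TensorProduct.tmul_smul, smul_smul, ← Finset.sum_smul, sum_counit_mul_counit]
    rw [← Finset.smul_sum, (ℛ R a).eq, piA_tm, map_smul]

theorem comul_piH (m : P.Bismash) :
    comul (R := R) (P.piH m) = TensorProduct.map P.piH P.piH (comul m) := by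
  induction m using P.induction_on with
  | h0 => simp
  | ha m n hm hn => simp only [map_add, hm, hn]
  | h a x =>
    have h1 : ∀ (c d : A) (y : H) (t : H ⊗[R] A), TensorProduct.map (P.piH ∘ₗ P.tm c)
        (P.piH ∘ₗ P.tm.flip y ∘ₗ LinearMap.mulLeft R d) t =
          (counit (R := R) d * counit (R := R) c) •
          TensorProduct.rid R H ((counit (R := R) (A := A)).lTensor H t) ⊗ₜ y := by
      intro c d y t
      induction t with
      | zero => simp
      | add s s' h h' => simp only [map_add, TensorProduct.add_tmul, smul_add, h, h']
      | tmul z b =>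
        simp only [TensorProduct.map_tmul, LinearMap.comp_apply, LinearMap.flip_apply,
          LinearMap.mulLeft_apply, piH_tm, LinearMap.lTensor_tmul, TensorProduct.rid_tmul,
          Bialgebra.counit_mul, TensorProduct.tmul_smul, TensorProduct.smul_tmul', smul_smul]
        congr 1
        ring_nf
    simp only [map_comul_tm, h1, P.coact_counit, ← Finset.smul_sum, (ℛ R x).eq]
    rw [← Finset.sum_smul, sum_counit_mul_counit, piH_tm, map_smul]

/-- This lets an `A # H`-coaction be rebuilt from its two projections; the opposite order,
`map_piH_piA_comul`, gives the exchange rule between them. -/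
theorem map_piA_piH_comul (a : A) (x : H) :
    TensorProduct.map P.piA P.piH (comul (P.tm a x)) = a ⊗ₜ x := by
  have h1 : ∀ (c d : A) (y : H) (t : H ⊗[R] A), TensorProduct.map (P.piA ∘ₗ P.tm c)
      (P.piH ∘ₗ P.tm.flip y ∘ₗ LinearMap.mulLeft R d) t =
        (counit (R := R) d • c) ⊗ₜ
        (counit (R := R) (TensorProduct.lid R A ((counit (R := R) (A := H)).rTensor A t)) • y) := by
    intro c d y t
    induction t with
    | zero => simp
    | add s s' h h' => simp only [map_add, TensorProduct.tmul_add, add_smul, h, h']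
    | tmul z b =>
      simp only [TensorProduct.map_tmul, LinearMap.comp_apply, LinearMap.flip_apply,
        LinearMap.mulLeft_apply, piH_tm, piA_tm, LinearMap.rTensor_tmul, TensorProduct.lid_tmul,
        Bialgebra.counit_mul, TensorProduct.tmul_smul, TensorProduct.smul_tmul', smul_smul,
        map_smul, smul_eq_mul]
      congr 1
      ring_nf
  simp only [map_comul_tm, h1, P.counit_coact, Algebra.algebraMap_eq_smul_one, map_smul,
    Bialgebra.counit_one, smul_eq_mul, mul_one, ← TensorProduct.tmul_sum,
    Coalgebra.sum_counit_smul]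
  rw [← TensorProduct.sum_tmul, sum_counit_smul_left]

theorem map_piH_piA_comul (a : A) (x : H) :
    TensorProduct.map P.piH P.piA (comul (P.tm a x)) = (1 ⊗ₜ a) * P.coact x := by
  have h1 : ∀ (c d : A) (y : H) (t : H ⊗[R] A), TensorProduct.map (P.piH ∘ₗ P.tm c)
      (P.piA ∘ₗ P.tm.flip y ∘ₗ LinearMap.mulLeft R d) t =
        (1 ⊗ₜ (counit (R := R) c • d)) * (counit (R := R) y • t) := by
    intro c d y t
    induction t with
    | zero => simp
    | add s s' h h' => simp only [map_add, mul_add, smul_add, h, h']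
    | tmul z b =>
      simp only [TensorProduct.map_tmul, LinearMap.comp_apply, LinearMap.flip_apply,
        LinearMap.mulLeft_apply, piH_tm, piA_tm, TensorProduct.tmul_smul, TensorProduct.smul_tmul',
        Algebra.TensorProduct.tmul_mul_tmul, one_mul, smul_mul_assoc, mul_smul_comm,
        smul_smul, mul_comm]
  simp only [map_comul_tm, h1, ← Finset.mul_sum, ← map_smul, ← map_sum, sum_counit_smul_left]
  rw [← Finset.sum_mul, ← TensorProduct.tmul_sum, Coalgebra.sum_counit_smul]

theorem counit_piA (m : P.Bismash) : counit (R := R) (P.piA m) = counit (R := R) m := by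
  induction m using P.induction_on with
  | h0 => simp
  | ha m n hm hn => simp only [map_add, hm, hn]
  | h a x => simp [piA_tm, counit_tm, mul_comm]

theorem counit_piH (m : P.Bismash) : counit (R := R) (P.piH m) = counit (R := R) m := by
  induction m using P.induction_on with
  | h0 => simp
  | ha m n hm hn => simp only [map_add, hm, hn]
  | h a x => simp [piH_tm, counit_tm]

end Projections

end LinkedPair
namespace LinkedPair

/-! ### Compactness of the bismash product. -/

section CQG
variable {A : Type u} {H : Type v} [Ring A] [Ring H] [HopfAlgebra ℂ A] [HopfAlgebra ℂ H]
  (P : LinkedPair ℂ A H) {V : Type w} [AddCommGroup V] [Module ℂ V]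

/-- The `A`-comodule underlying a comodule over `A # H`. -/
def comoduleA (δ : RightComodule P.Bismash V) : RightComodule A V :=
  δ.push P.piA P.comul_piA P.counit_piA

/-- The `H`-comodule underlying a comodule over `A # H`. -/
def comoduleH (δ : RightComodule P.Bismash V) : RightComodule H V :=
  δ.push P.piH P.comul_piH P.counit_piH

/-- `a ⊗ x ↦ ∑ x_H ⊗ a x_A` -/
def twist : A ⊗[ℂ] H →ₗ[ℂ] H ⊗[ℂ] A :=
  TensorProduct.map P.piH P.piA ∘ₗ comul ∘ₗ P.toB

theorem twist_tmul (a : A) (x : H) : P.twist (a ⊗ₜ x) = (1 ⊗ₜ a) * P.coact x :=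
  P.map_piH_piA_comul a x

/-- `∑ v₀ ⊗ v₁` is recovered from the coactions of `A` and `H`. -/
theorem coact_eq (δ : RightComodule P.Bismash V) (v : V) :
    δ.coact v = P.toB.lTensor V (TensorProduct.assoc ℂ V A H
      ((P.comoduleA δ).coact.rTensor H ((P.comoduleH δ).coact v))) := by
  have h1 : P.toB ∘ₗ TensorProduct.map P.piA P.piH ∘ₗ comul = LinearMap.id :=
    P.hom_ext fun a x => by
      simp only [LinearMap.comp_apply, map_piA_piH_comul]
      rfl
  have h2 := δ.assoc_rTensor_lTensor P.piA P.piH v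
  have h3 := congrArg (P.toB.lTensor V) h2
  rw [← LinearMap.lTensor_comp_apply, h1, LinearMap.lTensor_id] at h3
  exact h3.symm

/-- The left side is (`piH` ⊗ `piA`) Δ applied to the full coaction, which `coact_eq` expresses
through the coactions in the other order. -/
theorem coactH_coactA (δ : RightComodule P.Bismash V) (v : V) :
    TensorProduct.assoc ℂ V H A ((P.comoduleH δ).coact.rTensor A ((P.comoduleA δ).coact v)) =
      P.twist.lTensor V (TensorProduct.assoc ℂ V A H
        ((P.comoduleA δ).coact.rTensor H ((P.comoduleH δ).coact v))) := by
  refine (δ.assoc_rTensor_lTensor P.piH P.piA v).trans ?_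
  rw [P.coact_eq δ v, ← LinearMap.lTensor_comp_apply]
  rfl

variable [StarHopfAlgebra A] [StarHopfAlgebra H] {P}

/-- After the exchange rule, the invariance of `B` under `A` leaves scalars times ρ(y)* ρ(x), and h
turns these into h(y* x) 1. So the sum is the averaged form itself. -/
theorem isInvariant_comoduleA_avgForm
    (hρ : P.coact = bcv P.actT (starConj P.coact) LinearMap.id)
    {δ : RightComodule P.Bismash V} {B : V →ₗ[ℂ] V →ₗ⋆[ℂ] ℂ}
    (hB : (P.comoduleA δ).IsInvariant B)
    {h : H →ₗ[ℂ] ℂ} (hr : IsRightIntegral h) (hl : IsLeftIntegral h) (h₁ : h 1 = 1) :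
    (P.comoduleA δ).IsInvariant (avgForm B (P.comoduleH δ).coact h) := by
  rw [RightComodule.isInvariant_iff] at hB ⊢
  intro u v
  have h1 : ∀ (s t : V ⊗[ℂ] A) (x y : H),
      extForm B (P.twist.lTensor V (TensorProduct.assoc ℂ V A H (s ⊗ₜ x)))
        (P.twist.lTensor V (TensorProduct.assoc ℂ V A H (t ⊗ₜ y))) =
      star (P.coact y) * ((1 ⊗ₜ extForm B s t) * P.coact x) := by
    intro s t x y
    induction s with
    | zero => simp
    | add s s' h h' => simp only [TensorProduct.add_tmul, map_add, LinearMap.add_apply, h, h',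
        TensorProduct.tmul_add, add_mul, mul_add]
    | tmul u a =>
      induction t with
      | zero => simp
      | add s s' h h' => simp only [TensorProduct.add_tmul, map_add, h, h',
          TensorProduct.tmul_add, add_mul, mul_add]
      | tmul v b =>
        simp only [TensorProduct.assoc_tmul, LinearMap.lTensor_tmul, twist_tmul, extForm_tmul,
          star_mul, TensorProduct.star_tmul, star_one, TensorProduct.tmul_smul, smul_mul_assoc,
          mul_smul_comm, mul_assoc]
        rw [← mul_assoc (1 ⊗ₜ[ℂ] star b), Algebra.TensorProduct.tmul_mul_tmul, one_mul]
  have h2 : ∀ m n : V ⊗[ℂ] H, TensorProduct.lid ℂ A (h.rTensor A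
      (extForm B
        (P.twist.lTensor V (TensorProduct.assoc ℂ V A H ((P.comoduleA δ).coact.rTensor H m)))
        (P.twist.lTensor V (TensorProduct.assoc ℂ V A H ((P.comoduleA δ).coact.rTensor H n))))) =
      h (extForm B m n) • (1 : A) := by
    intro m n
    induction m with
    | zero => simp
    | add s s' h h' => simp only [map_add, LinearMap.add_apply, h, h', add_smul]
    | tmul u x =>
      induction n with
      | zero => simp
      | add s s' h h' => simp only [map_add, h, h', add_smul]
      | tmul v y =>
        rw [LinearMap.rTensor_tmul, LinearMap.rTensor_tmul, h1, hB, TensorProduct.tmul_smul,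
          ← Algebra.TensorProduct.one_def, smul_mul_assoc, one_mul, mul_smul_comm, map_smul,
          map_smul, P.lid_rTensor_star_coact_mul hρ hr hl h₁, extForm_tmul, map_smul, smul_smul,
          smul_eq_mul]
  rw [extForm_avgForm, coactH_coactA, coactH_coactA, h2, avgForm_apply]

/-- For v₁ = b # y and u₁ = a # x one has v₁* u₁ = (1 # y*)(b* a # 1)(1 # x). The inner sum
collapses by `A`-invariance and the outer one by `H`-invariance. -/
theorem isInvariant_of_comoduleA_of_comoduleH [StarHopfAlgebra P.Bismash]
    (hs : P.IsBismashStar star) {δ : RightComodule P.Bismash V} {B : V →ₗ[ℂ] V →ₗ⋆[ℂ] ℂ}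
    (hA : (P.comoduleA δ).IsInvariant B) (hH : (P.comoduleH δ).IsInvariant B) :
    δ.IsInvariant B := by
  rw [isBismashStar_iff] at hs
  rw [RightComodule.isInvariant_iff] at hA hH ⊢
  intro u v
  have h1 : ∀ (s t : V ⊗[ℂ] A) (x y : H),
      extForm B (P.toB.lTensor V (TensorProduct.assoc ℂ V A H (s ⊗ₜ x)))
        (P.toB.lTensor V (TensorProduct.assoc ℂ V A H (t ⊗ₜ y))) =
      P.inH (star y) * (P.inA (extForm B s t) * P.inH x) := by
    intro s t x y
    induction s with
    | zero => simp
    | add s s' h h' => simp only [TensorProduct.add_tmul, map_add, LinearMap.add_apply, h, h',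
        add_mul, mul_add]
    | tmul u a =>
      induction t with
      | zero => simp
      | add s s' h h' => simp only [TensorProduct.add_tmul, map_add, h, h', add_mul, mul_add]
      | tmul v b =>
        simp only [TensorProduct.assoc_tmul, LinearMap.lTensor_tmul, toB_tmul, extForm_tmul, hs,
          map_smul, map_mul, smul_mul_assoc, mul_smul_comm, mul_assoc]
        rw [← P.inA_mul_inH a x]
  have h2 : ∀ m n : V ⊗[ℂ] H,
      extForm B
        (P.toB.lTensor V (TensorProduct.assoc ℂ V A H ((P.comoduleA δ).coact.rTensor H m)))
        (P.toB.lTensor V (TensorProduct.assoc ℂ V A H ((P.comoduleA δ).coact.rTensor H n))) =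
      P.inH (extForm B m n) := by
    intro m n
    induction m with
    | zero => simp
    | add s s' h h' => simp only [map_add, LinearMap.add_apply, h, h']
    | tmul u x =>
      induction n with
      | zero => simp
      | add s s' h h' => simp only [map_add, h, h']
      | tmul v y =>
        rw [LinearMap.rTensor_tmul, LinearMap.rTensor_tmul, h1, hA, map_smul, map_one,
          smul_mul_assoc, one_mul, mul_smul_comm, ← map_mul, extForm_tmul, map_smul]
  rw [P.coact_eq δ u, P.coact_eq δ v, h2, hH, map_smul, map_one]

/-- The average is the pullback along the coaction of a positive definite form on V ⊗ H, and the
coaction is injective by the counit axiom. -/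
theorem isInnerProduct_avgForm [FiniteDimensional ℂ H] (ρ : RightComodule H V)
    {B : V →ₗ[ℂ] V →ₗ⋆[ℂ] ℂ} (hB : IsInnerProduct B) {h : H →ₗ[ℂ] ℂ}
    (hstar : ∀ x, h (star x) = conj (h x)) (hpos : IsInnerProduct (mulForm h)) :
    IsInnerProduct (avgForm B ρ.coact h) := by
  refine ⟨fun u v => ?_, fun v hv => hB.extForm_pos hpos h (mulForm_apply h) _ fun h0 => hv ?_⟩
  · rw [avgForm_apply, avgForm_apply, ← star_extForm B hB.1, hstar]
  · rw [← ρ.counit_coact v, h0, map_zero, map_zero]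

/-- If `A` and `H` are compact quantum groups and `H` is finite, then `A # H` is a compact quantum
group. -/
theorem isCQG_bismash [StarHopfAlgebra P.Bismash] (hs : P.IsBismashStar star)
    [FiniteDimensional ℂ H] (hA : IsCQG.{u, w} A) (hH : IsCQG.{v, w} H) :
    IsCQG.{max u v, w} P.Bismash := by
  intro V _ _ δ
  obtain ⟨h, hr, hl, h₁, hstar, hpos⟩ := hH.exists_haar
  -- The compatibility of ρ with stars is extracted from the given `*`-structure through the
  -- equivalence already proved.
  have hρ := P.star_coact_iff.1 (P.starHopfAlgebra_iff.1 ⟨_, hs⟩).2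
  obtain ⟨B, hB, hinv⟩ := hA V (P.comoduleA δ)
  exact ⟨avgForm B (P.comoduleH δ).coact h, isInnerProduct_avgForm _ hB hstar hpos,
    isInvariant_of_comoduleA_of_comoduleH hs
      (isInvariant_comoduleA_avgForm hρ hinv hr hl h₁)
      (RightComodule.isInvariant_avgForm _ _ hr)⟩

end CQG
end LinkedPair
end QuantumLinkedPair
end

theorem mainTheorem9 {A : Type u} {H : Type v} [Ring A] [Ring H]
    [HopfAlgebra ℂ A] [HopfAlgebra ℂ H] [StarHopfAlgebra A] [StarHopfAlgebra H]
    (P : LinkedPair ℂ A H) :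
    ((∃ _ : StarHopfAlgebra P.Bismash, P.IsBismashStar star) ↔
      ((∀ (x : H) (a : A),
          star (P.act x a) = P.act ((antipodeEquiv H).symm (star x)) (star a)) ∧
        (∀ x : H, P.coact (star x) = ∑ i ∈ (ℛ ℂ x).index,
          (P.act (star ((ℛ ℂ x).right i))).lTensor H (star (P.coact ((ℛ ℂ x).left i)))))) ∧
    (∀ [StarHopfAlgebra P.Bismash], P.IsBismashStar star →
      FiniteDimensional ℂ A → FiniteDimensional ℂ H → IsCQG.{u, w} A → IsCQG.{v, w} H →
        FiniteDimensional ℂ P.Bismash ∧ IsCQG.{max u v, w} P.Bismash) := by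
  refine ⟨P.starHopfAlgebra_iff, fun hs _ _ hA hH => ⟨?_, LinkedPair.isCQG_bismash hs hA hH⟩⟩
  exact inferInstanceAs (FiniteDimensional ℂ (A ⊗[ℂ] H))
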